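/- Let $\lambda = 1+\sqrt2$ and write $e_j=e^{i\pi j/4}$ for $j\in\mathbb Z/8$. The prototiles are the rhombus of side $1$ and angle $45^\circ$, and the isosceles right triangle with legs of length $1$ whose hypotenuse carries an arrow from one end (the tail) to the other (the head). All sides of the rhombi and all legs of the triangles have directions that are multiples of $45^\circ$. The Ammann–Beenker inflation $\sigma$ replaces each tile by the following dissection of its image under $z\mapsto\lambda z$. * A rhombus with an acute corner at $p$ and sides from there in the directions $e_j,e_{j+1}$: put $P=\lambda p$, $M=P+e_j+e_{j+1}$, $N=M+e_{j+7}+e_{j+2}$. The pieces are the rhombi with an acute corner at $P$, $M+e_{j+7}$, $N$ and sides from there in the directions $(e_j,e_{j+1})$, $(e_{j+2},e_{j+3})$, $(e_j,e_{j+1})$ respectively, and the triangles with right angle, head, tail equal to $(M,\,M+e_{j+2},\,M+e_{j+4})$, $(M,\,M+e_{j+7},\,M+e_{j+5})$, $(N,\,N+e_{j+6},\,N+e_j)$, $(N,\,N+e_{j+3},\,N+e_{j+1})$. * A triangle with right angle $a$, head $a+e_h$ and tail $a+e_{h+2\varepsilon}$, $\varepsilon=\pm1$: put $X=\lambda a$,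 $E=X+e_{h+\varepsilon}$, $F=E+e_{h+2\varepsilon}$. The pieces are the triangles with right angle, head, tail equal to $(F,\,F+e_{h+3\varepsilon},\,F+e_{h+5\varepsilon})$, $(E,\,E+e_{h+2\varepsilon},\,E+e_h)$, $(E,\,E+e_{h+5\varepsilon},\,E+e_{h+7\varepsilon})$, and the rhombi with an acute corner at $F$ and sides from there in the directions $e_{h+5\varepsilon},e_{h+6\varepsilon}$, and with an acute corner at $E$ and sides from there in the directions $e_{h-\varepsilon},e_h$. An Ammann–Beenker tiling is a tiling of the plane $\mathbb C$ by such tiles in which every finite patch is contained in $\sigma^n(t)$ for some tile $t$ and some $n\ge 0$. Its graph has the corners of the tiles as vertices and the sides of the tiles as edges. **Theorem 4.1.** Let $T$ be an Ammann–Beenker tiling. Then its graph has chromatic number $3$. Moreover, $T=\sigma^2(S)$ for some Ammann–Beenker tiling $S$, and for every such $S$ the following hold, where the second-level supertile of a region $K$ is $\lambda^2K$, and its border is the subgraph of the graph of $T$ formed by the vertices and edges that lie on the topological boundary of $\lambda^2K$. 1. The border of the second-level supertile of each rhombus of $S$ is a cycle of length $20$. 2. Each triangle of $S$ shares its hypotenuse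 with exactly one other triangle of $S$; the two form a unit square, and the border of the second-level supertile of this square is a cycle of length $20$. 3. The union of the borders of the second-level supertiles of all these rhombi and squares is $2$-colourable, and every proper $2$-colouring of this union extends to a proper $3$-colouring of the graph of $T$ (so that the third colour is used only for vertices not on these borders). -/

import Mathlib

namespace AmmannBeenker

/-- The inflation factor `1 + √2`. -/
noncomputable def lam : ℝ := 1 + Real.sqrt 2

/-- The unit vector at angle `k · 45°`. -/
noncomputable def dir (k : ZMod 8) : ℂ :=
  Complex.exp (((k.val : ℝ) * (Real.pi / 4) : ℝ) * Complex.I)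

/-- The sign `+1` (for `true`) or `-1` (for `false`) modulo 8: the chirality of a triangle. -/
def sgn (e : Bool) : ZMod 8 := if e then 1 else -1

/-- The two prototiles in all their orientations, placed anywhere in the plane `ℂ`.
* `rhomb p k` is the 45° rhombus of side 1 with an acute corner at `p`, from which its sides leave
  in the directions `k · 45°` and `(k + 1) · 45°`. (At the opposite acute corner the sides leave in
  the directions `k + 4`, `k + 5`, so four values of `k` name every rhombus exactly once.)
* `tri a h e` is the isosceles right triangle with legs of length 1, with its right angle at `a`,
  one leg in the direction `h` and the other in the direction `h ± 2`. Its hypotenuse carries an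
  arrow, which points to the end of the leg of direction `h` (the *head*), away from the end of
  the other leg (the *tail*). -/
inductive Tile where
  | rhomb (p : ℂ) (k : Fin 4) : Tile
  | tri (a : ℂ) (h : ZMod 8) (e : Bool) : Tile

/-- The rhombus with an acute corner at `p` and sides from there in the directions `k`, `k + 1`. -/
noncomputable def mkRhomb (p : ℂ) (k : ZMod 8) : Tile :=
  if k.val < 4 then .rhomb p (Fin.ofNat 4 k.val)
  else .rhomb (p + dir k + dir (k + 1)) (Fin.ofNat 4 (k.val - 4))

/-- The rhombus with an acute corner at `p` and sides from there in the directions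
`k` and `k + sgn e`. -/
noncomputable def mkRhombSgn (p : ℂ) (k : ZMod 8) (e : Bool) : Tile :=
  if e then mkRhomb p k else mkRhomb p (k - 1)

namespace Tile

/-- The corners of a tile. -/
noncomputable def corners : Tile → Set ℂ
  | rhomb p k => {p, p + dir k.val, p + dir k.val + dir (k.val + 1), p + dir (k.val + 1)}
  | tri a h e => {a, a + dir h, a + dir (h + 2 * sgn e)}

/-- The sides of a tile, as unordered pairs of corners. -/
noncomputable def sides : Tile → Set (Sym2 ℂ)
  | rhomb p k =>
      {s(p, p + dir k.val),
       s(p + dir k.val, p + dir k.val + dir (k.val + 1)),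
       s(p + dir k.val + dir (k.val + 1), p + dir (k.val + 1)),
       s(p + dir (k.val + 1), p)}
  | tri a h e =>
      {s(a, a + dir h),
       s(a + dir h, a + dir (h + 2 * sgn e)),
       s(a + dir (h + 2 * sgn e), a)}

/-- The closed region of the plane that a tile occupies. -/
noncomputable def region (t : Tile) : Set ℂ := convexHull ℝ t.corners

def IsRhomb : Tile → Prop
  | rhomb _ _ => True
  | tri _ _ _ => False

def IsTri : Tile → Prop
  | rhomb _ _ => False
  | tri _ _ _ => True

/-- Two different triangles with the same hypotenuse. -/
def SharesHypotenuse : Tile → Tile → Prop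
  | tri a h e, tri a' h' e' =>
      tri a h e ≠ tri a' h' e' ∧
      s(a + dir h, a + dir (h + 2 * sgn e)) = s(a' + dir h', a' + dir (h' + 2 * sgn e'))
  | _, _ => False

/-- The inflation rule: the tile is magnified by `lam` about the origin and dissected.
A rhombus becomes three rhombi and four triangles. A triangle becomes three triangles and two
rhombi. The arrows of the small triangles are part of the rule. -/
noncomputable def children : Tile → List Tile
  | rhomb p k =>
      let j : ZMod 8 := k.val
      -- the lower-left acute corner of the inflated rhombus, and two points on its long diagonal
      let P : ℂ := lam * p
      let M : ℂ := P + dir j + dir (j + 1)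
      let N : ℂ := M + dir (j + 7) + dir (j + 2)
      [mkRhomb P j,
       mkRhomb (M + dir (j + 7)) (j + 2),
       mkRhomb N j,
       tri M (j + 2) true,
       tri M (j + 7) false,
       tri N (j + 6) true,
       tri N (j + 3) false]
  | tri a h e =>
      let ε : ZMod 8 := sgn e
      -- the right-angled corner of the inflated triangle, an interior point of it,
      -- and a point on its hypotenuse
      let X : ℂ := lam * a
      let E : ℂ := X + dir (h + ε)
      let F : ℂ := X + dir (h + 2 * ε) + dir (h + ε)
      [tri F (h + 3 * ε) e,
       tri E (h + 2 * ε) (!e),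
       tri E (h + 5 * ε) e,
       mkRhombSgn F (h + 5 * ε) e,
       mkRhombSgn E (h - ε) e]

end Tile

/-- The substitution on collections of tiles: inflate, and dissect every tile. -/
def subst (S : Set Tile) : Set Tile := {c | ∃ t ∈ S, c ∈ t.children}

/-- A tiling of the plane: the tiles cover it and have pairwise disjoint interiors. -/
def IsTiling (T : Set Tile) : Prop :=
  (⋃ t ∈ T, t.region) = Set.univ ∧
    T.Pairwise fun s t => Disjoint (interior s.region) (interior t.region)

/-- The Ammann–Beenker tilings: the tilings of the plane generated by the inflation rule, that is,
every finite patch occurs in the `n`-fold inflation of a single tile for some `n`. -/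
def IsAmmannBeenker (T : Set Tile) : Prop :=
  IsTiling T ∧
    ∀ P : Set Tile, P.Finite → P ⊆ T → ∃ (n : ℕ) (t : Tile), P ⊆ subst^[n] {t}

/-- The vertices of a tiling: the corners of its tiles. -/
def vertexSet (T : Set Tile) : Set ℂ := {z | ∃ t ∈ T, z ∈ t.corners}

/-- The graph of a tiling: its edges are the sides of the tiles. -/
def graph (T : Set Tile) : SimpleGraph (vertexSet T) where
  Adj v w := v ≠ w ∧ ∃ t ∈ T, s((v : ℂ), (w : ℂ)) ∈ t.sides
  symm := ⟨fun v w h => ⟨h.1.symm, by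
    obtain ⟨t, ht, hs⟩ := h.2
    exact ⟨t, ht, by rwa [Sym2.eq_swap]⟩⟩⟩
  loopless := ⟨fun _ h => h.1 rfl⟩

/-- The region of the second-level supertile of a tile or group of tiles with region `K`:
`K` magnified by `lam ^ 2`. -/
def supertile (K : Set ℂ) : Set ℂ := (fun z : ℂ => ((lam ^ 2 : ℝ) : ℂ) * z) '' K

/-- The part of the graph of `T` that runs along the boundary of a region `K` of the plane. -/
def border (T : Set Tile) (K : Set ℂ) : (graph T).Subgraph where
  verts := {v | (v : ℂ) ∈ frontier K}
  Adj v w := (graph T).Adj v w ∧ segment ℝ (v : ℂ) (w : ℂ) ⊆ frontier K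
  adj_sub h := h.1
  edge_vert h := h.2 (left_mem_segment ℝ _ _)
  symm := ⟨fun v w h => ⟨h.1.symm, by rw [segment_symm]; exact h.2⟩⟩

/-- The rhombi of `S`, and the squares that two triangles of `S` with a common hypotenuse form. -/
def blocks (S : Set Tile) : Set (Set ℂ) :=
  {K | ∃ t ∈ S, t.IsRhomb ∧ K = t.region} ∪
  {K | ∃ t ∈ S, ∃ t' ∈ S, t.SharesHypotenuse t' ∧ K = t.region ∪ t'.region}

/-- The union of the borders, in the graph of `T`, of the second-level supertiles of `T`
(triangles being taken in pairs), where `S` is the tiling whose two-fold inflation is `T`. -/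
def borders (T S : Set Tile) : (graph T).Subgraph :=
  ⨆ K ∈ blocks S, border T (supertile K)

/-- A closed square of side 1. -/
def IsUnitSquare (K : Set ℂ) : Prop :=
  ∃ p u : ℂ, ‖u‖ = 1 ∧
    K = convexHull ℝ {p, p + u, p + u + Complex.I * u, p + Complex.I * u}

/-- A subgraph that is a cycle of length `n`. -/
def IsCycleOfLength {V : Type} {G : SimpleGraph V} (B : G.Subgraph) (n : ℕ) : Prop :=
  Nonempty (B.coe ≃g SimpleGraph.cycleGraph n)

end AmmannBeenker

/-! Inflating twice multiplies lengths by λ² = 2λ + 1 and turns a side of length 1 into a straight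
path of five edges of lengths 1, √2, 1, √2, 1. A block (a rhombus, or two triangles glued along
their hypotenuse) has four unit sides, so the border of its second-level supertile is a cycle of 4 ·
5 = 20 edges (`isCycleOfLength_border`).

The vertices of S lie in a translate of ℤ[ζ₈], where the parity of the coordinate sum changes along
every unit vector. Five is odd, so colouring λ²x by the parity of x and alternating along the paths
gives a consistent 2-colouring of all borders (`borders_colorable`). Up to translation, rotation and
reflection there is one rhombus and one triangle; explicit 3-colourings of their interiors,
compatible with this 2-colouring, are listed in `table` and checked in `table_proper`. An arbitrary
2-colouring of the borders differs from the standard one by a constant on each tile of S, so on each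
tile one uses the listed colouring with the first two colours exchanged or not (`exists_extension`).
Two colours never suffice, because a triangle is a 3-cycle.

The geometry is reduced to integer arithmetic as follows. Tiles are split into open cells: vertices,
directed unit edges, directed hypotenuses, open tiles. The dissection of an inflated cell depends on
the cell alone and not on the tile it bounds (`mem_cells_lsubst`). Hence "overlapping cells are
equal" (`IsComplex`) is inherited under inflation, so it holds in every inflated tile and, as any
two tiles lie together in such a patch, in every Ammann–Beenker tiling
(`IsAmmannBeenker.exists_place`). What remains about single cells and blocks is a finite check over
the shapes.

That T is an inflation follows by compactness (`IsAmmannBeenker.exists_subst_eq`): finite patches of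
T lie in inflated tiles, and since a tile has only finitely many possible parents, an ultrafilter
limit of the patches one level lower is a tiling S with `subst S = T`. -/

namespace AmmannBeenker

/-! ### Lattice coordinates, cells, and the inflation of cells -/

/-- Points of the lattice `ℤ[ζ₈]`, in the basis `1, ζ, ζ², ζ³`. -/
abbrev Pt := ℤ × ℤ × ℤ × ℤ

/-- The unit vectors of the lattice. -/
def ldir (k : ZMod 8) : Pt :=
  match k.val with
  | 0 => (1, 0, 0, 0)
  | 1 => (0, 1, 0, 0)
  | 2 => (0, 0, 1, 0)
  | 3 => (0, 0, 0, 1)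
  | 4 => (-1, 0, 0, 0)
  | 5 => (0, -1, 0, 0)
  | 6 => (0, 0, -1, 0)
  | _ => (0, 0, 0, -1)

/-- Multiplication by `√2` in the lattice. -/
def mulSqrt (x : Pt) : Pt :=
  (x.2.1 - x.2.2.2, x.1 + x.2.2.1, x.2.1 + x.2.2.2, x.2.2.1 - x.1)

/-- Multiplication by `1 + √2` in the lattice. -/
def mulLam (x : Pt) : Pt := x + mulSqrt x

/-- Shapes of tiles. -/
inductive TileShape where
  | rhomb (k : Fin 4) : TileShape
  | tri (h : ZMod 8) (e : Bool) : TileShape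
  deriving DecidableEq

/-- Shapes of the cells of a tiling: vertices, unit edges (with a direction), hypotenuses (with the
direction from the tail to the head), and tiles. -/
inductive Shape where
  | vert : Shape
  | unit (k : ZMod 8) : Shape
  | hyp (k : ZMod 8) : Shape
  | tile (s : TileShape) : Shape
  deriving DecidableEq

abbrev LTile := Pt × TileShape

abbrev Cell := Pt × Shape

/-- Translation of a located shape. -/
def shift {α : Type} (x : Pt) (c : Pt × α) : Pt × α := (x + c.1, c.2)

def lrhomb (p : Pt) (k : ZMod 8) : LTile :=
  if k.val < 4 then (p, .rhomb (Fin.ofNat 4 k.val))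
  else (p + ldir k + ldir (k + 1), .rhomb (Fin.ofNat 4 (k.val - 4)))

def lrhombSgn (p : Pt) (k : ZMod 8) (e : Bool) : LTile :=
  if e then lrhomb p k else lrhomb p (k - 1)

/-- The dissection of an inflated tile that is based at the origin. -/
def kids : TileShape → List LTile
  | .rhomb k =>
      let j : ZMod 8 := k.val
      let M : Pt := ldir j + ldir (j + 1)
      let N : Pt := M + ldir (j + 7) + ldir (j + 2)
      [lrhomb 0 j,
       lrhomb (M + ldir (j + 7)) (j + 2),
       lrhomb N j,
       (M, .tri (j + 2) true),
       (M, .tri (j + 7) false),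
       (N, .tri (j + 6) true),
       (N, .tri (j + 3) false)]
  | .tri h e =>
      let ε : ZMod 8 := sgn e
      let E : Pt := ldir (h + ε)
      let F : Pt := ldir (h + 2 * ε) + ldir (h + ε)
      [(F, .tri (h + 3 * ε) e),
       (E, .tri (h + 2 * ε) (!e)),
       (E, .tri (h + 5 * ε) e),
       lrhombSgn F (h + 5 * ε) e,
       lrhombSgn E (h - ε) e]

/-- The vertices of a shape. -/
def Shape.verts : Shape → List Pt
  | .vert => [0]
  | .unit k => [0, ldir k]
  | .hyp k => [0, mulSqrt (ldir k)]
  | .tile (.rhomb k) =>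
      [0, ldir k.val, ldir k.val + ldir (k.val + 1), ldir (k.val + 1)]
  | .tile (.tri h e) => [0, ldir h, ldir (h + 2 * sgn e)]

def Cell.verts (c : Cell) : List Pt := c.2.verts.map (c.1 + ·)

/-- The sides of a tile shape, with their directions. -/
def TileShape.edges : TileShape → List Cell
  -- Unit sides are directed so that inflation cuts each into a unit edge followed by a hypotenuse.
  -- They leave the acute corners of a rhombus; round a triangle the directions run head, right
  -- angle, tail, head.
  | .rhomb k =>
      let w := ldir k.val + ldir (k.val + 1)
      [(0, .unit k.val), (0, .unit (k.val + 1)), (w, .unit (k.val + 4)), (w, .unit (k.val + 5))]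
  | .tri h e =>
      [(ldir h, .unit (h + 4)), (0, .unit (h + 2 * sgn e)),
       (ldir (h + 2 * sgn e), .hyp (h - sgn e))]

/-- The proper faces of a shape. -/
def Shape.boundary : Shape → List Cell
  | .vert => []
  | .tile s => (Shape.tile s).verts.map (·, .vert) ++ s.edges
  | s => s.verts.map (·, .vert)

/-- The faces of a shape. -/
def Shape.faces (s : Shape) : List Cell := (0, s) :: s.boundary

def Cell.faces (c : Cell) : List Cell := c.2.faces.map (shift c.1)

def LTile.cell (t : LTile) : Cell := (t.1, .tile t.2)

/-- The open cells into which the inflated shape is dissected. -/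
def Shape.sub : Shape → List Cell
  | .tile (.rhomb k) =>
      let j : ZMod 8 := k.val
      let M : Pt := ldir j + ldir (j + 1)
      let A : Pt := M + ldir (j + 7)
      let N : Pt := A + ldir (j + 2)
      let B : Pt := N + ldir (j + 3)
      (kids (.rhomb k)).map LTile.cell ++
        [(M, .vert), (N, .vert), (M, .unit (j + 4)), (M, .unit (j + 5)),
          (A, .unit (j + 2)), (A, .unit (j + 3)), (B, .unit (j + 6)), (B, .unit (j + 7)),
          (N, .unit j), (N, .unit (j + 1))]
  | .tile (.tri h e) =>
      let ε : ZMod 8 := sgn e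
      let E : Pt := ldir (h + ε)
      let F : Pt := ldir (h + 2 * ε) + ldir (h + ε)
      (kids (.tri h e)).map LTile.cell ++
        [(E, .vert), (0, .unit (h + ε)), (F, .unit (h + 6 * ε)), (F, .unit (h + 5 * ε)),
          (E, .unit (h - ε)), (E, .unit h)]
  | .vert => [(0, .vert)]
  -- λ = 1 + √2 is cut asymmetrically, which is why unit edges need a direction. For a hypotenuse,
  -- √2 λ = 1 + √2 + 1, and the two later pieces are directed backwards.
  | .unit k => [(0, .unit k), (ldir k, .vert), (ldir k, .hyp k)]
  | .hyp k =>
      let f := ldir k + mulSqrt (ldir k)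
      [(0, .unit k), (ldir k, .vert), (f, .hyp (k + 4)), (f, .vert), (f + ldir k, .unit (k + 4))]

def Cell.sub (c : Cell) : List Cell := c.2.sub.map (shift (mulLam c.1))

def dirs : List (ZMod 8) := [0, 1, 2, 3, 4, 5, 6, 7]

def tileShapes : List TileShape :=
  [0, 1, 2, 3].map .rhomb ++ dirs.map (.tri · true) ++ dirs.map (.tri · false)

def shapes : List Shape :=
  .vert :: dirs.map .unit ++ dirs.map .hyp ++ tileShapes.map .tile

/-! ### Exact tests for separation and containment, using eight linear forms -/

/-- The number `m + n√2 = √2 · Im (x · conj (dir k))` as the pair `(m, n)`. -/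
def lform (k : ZMod 8) (x : Pt) : ℤ × ℤ :=
  match k.val with
  | 0 => (x.2.1 + x.2.2.2, x.2.2.1)
  | 1 => (x.2.2.1 - x.1, x.2.2.2)
  | 2 => (x.2.2.2 - x.2.1, -x.1)
  | 3 => (-x.1 - x.2.2.1, -x.2.1)
  | 4 => (-x.2.1 - x.2.2.2, -x.2.2.1)
  | 5 => (x.1 - x.2.2.1, -x.2.2.2)
  | 6 => (x.2.1 - x.2.2.2, x.1)
  | _ => (x.1 + x.2.2.1, x.2.1)

/-- A test for `0 ≤ m + n√2`. -/
def nonneg (a : ℤ × ℤ) : Bool :=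
  (decide (0 ≤ a.1) && (decide (0 ≤ a.2) || decide (2 * (a.2 * a.2) ≤ a.1 * a.1))) ||
    (decide (0 ≤ a.2) && decide (a.1 * a.1 ≤ 2 * (a.2 * a.2)))

def lle (k : ZMod 8) (u v : Pt) : Bool := nonneg (lform k (v - u))

def leq (k : ZMod 8) (u v : Pt) : Bool := lform k (v - u) == (0, 0)

def llt (k : ZMod 8) (u v : Pt) : Bool := lle k u v && !leq k u v

/-- A test for the hulls of `V` and `W` to be separated by a line of one of the eight directions. -/
def sep (V W : List Pt) : Bool :=
  dirs.any fun k => (V.all fun v => W.all fun w => lle k v w) && V.any fun v => W.any fun w =>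
    llt k v w

/-- A test for the relative interior of the hull of `V` to lie in that of the hull of `U`. -/
def inside (V U : List Pt) : Bool :=
  dirs.all fun k => (U.any fun u => (V.all fun v => lle k v u) && V.any fun v => llt k v u) ||
    U.all fun u => V.all fun v => leq k u v

def pairwiseSep : List (List Pt) → Bool
  | [] => true
  | V :: l => (l.all fun W => sep V W) && pairwiseSep l

/-! Combinators that make the kernel evaluate an argument before it is used. -/

noncomputable def forceNat {β : Type} (n : ℕ) (f : ℕ → β) : β :=
  Nat.rec (f 0) (fun k _ => f (Nat.succ k)) n

noncomputable def forceInt {β : Type} (z : ℤ) (f : ℤ → β) : β :=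
  Int.rec (fun n => forceNat n fun n => f (.ofNat n)) (fun n => forceNat n fun n => f (.negSucc n)) z

noncomputable def forcePt {β : Type} (x : Pt) (f : Pt → β) : β :=
  forceInt x.1 fun a => forceInt x.2.1 fun b => forceInt x.2.2.1 fun c => forceInt x.2.2.2 fun d =>
    f (a, b, c, d)

def forceDir {β : Type} (k : ZMod 8) (f : ZMod 8 → β) : β :=
  match k with
  | 0 => f 0
  | 1 => f 1
  | 2 => f 2
  | 3 => f 3
  | 4 => f 4
  | 5 => f 5
  | 6 => f 6
  | 7 => f 7

def forceShape {β : Type} (s : Shape) (f : Shape → β) : β :=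
  match s with
  | .vert => f .vert
  | .unit k => forceDir k fun k => f (.unit k)
  | .hyp k => forceDir k fun k => f (.hyp k)
  | .tile (.rhomb 0) => f (.tile (.rhomb 0))
  | .tile (.rhomb 1) => f (.tile (.rhomb 1))
  | .tile (.rhomb 2) => f (.tile (.rhomb 2))
  | .tile (.rhomb 3) => f (.tile (.rhomb 3))
  | .tile (.tri h true) => forceDir h fun h => f (.tile (.tri h true))
  | .tile (.tri h false) => forceDir h fun h => f (.tile (.tri h false))

noncomputable def forceCell {β : Type} (c : Cell) (f : Cell → β) : β :=
  forcePt c.1 fun x => forceShape c.2 fun s => f (x, s)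

def forceList {α β : Type} (force : α → (α → β) → β) (l : List α) (f : List α → β) : β :=
  match l with
  | [] => f []
  | a :: l => force a fun a => forceList force l fun l => f (a :: l)

/-- Each combinator is plain application, so a check stated with forced arguments, which is what
`decide +kernel` evaluates, yields the readable statement. -/
theorem forceNat_eq {β : Type} (n : ℕ) (f : ℕ → β) : forceNat n f = f n := by cases n <;> rfl

theorem forceInt_eq {β : Type} (z : ℤ) (f : ℤ → β) : forceInt z f = f z := by
  rcases z with n | n
  · exact forceNat_eq n fun n => f (.ofNat n)
  · exact forceNat_eq n fun n => f (.negSucc n)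

theorem forcePt_eq {β : Type} (x : Pt) (f : Pt → β) : forcePt x f = f x := by
  simp only [forcePt, forceInt_eq]

theorem forceDir_eq {β : Type} (k : ZMod 8) (f : ZMod 8 → β) : forceDir k f = f k := by
  fin_cases k <;> rfl

theorem forceShape_eq {β : Type} (s : Shape) (f : Shape → β) : forceShape s f = f s := by
  obtain _ | k | k | k | ⟨h, _ | _⟩ := s
  · rfl
  · exact forceDir_eq k fun k => f (.unit k)
  · exact forceDir_eq k fun k => f (.hyp k)
  · fin_cases k <;> rfl
  · exact forceDir_eq h fun h => f (.tile (.tri h false))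
  · exact forceDir_eq h fun h => f (.tile (.tri h true))

theorem forceCell_eq {β : Type} (c : Cell) (f : Cell → β) : forceCell c f = f c := by
  simp only [forceCell, forcePt_eq, forceShape_eq]

theorem forceList_eq {α β : Type} {force : α → (α → β) → β} (hf : ∀ a f, force a f = f a)
    (l : List α) (f : List α → β) : forceList force l f = f l := by
  induction l generalizing f with
  | nil => rfl
  | cons a l ih => simp only [forceList, hf, ih]

/-! ### Finite verification of the inflation rule on cells -/

theorem any_contains {α β : Type} [BEq β] (l : List α) (F : α → List β) (b : β) :
    (l.any fun a => (F a).contains b) = (l.flatMap F).contains b := by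
  simp only [List.contains_eq_any_beq, List.any_flatMap]

theorem sub_pairwiseSep : (shapes.all fun s => pairwiseSep (s.sub.map Cell.verts)) = true := by
  have h : (shapes.all fun s =>
      forceList (forceList forcePt) (s.sub.map Cell.verts) pairwiseSep) = true := by decide +kernel
  simpa only [forceList_eq (forceList_eq forcePt_eq)] using h

theorem faces_pairwiseSep :
    (tileShapes.all fun s => pairwiseSep ((Shape.tile s).faces.map Cell.verts)) = true := by
  have h : (tileShapes.all fun s => forceList (forceList forcePt)
      ((Shape.tile s).faces.map Cell.verts) pairwiseSep) = true := by decide +kernel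
  simpa only [forceList_eq (forceList_eq forcePt_eq)] using h

theorem sub_inside : (shapes.all fun s => s.sub.all fun g =>
    inside g.verts (s.verts.map mulLam)) = true := by
  have h : (shapes.all fun s => forceList forcePt (s.verts.map mulLam) fun U => s.sub.all fun g =>
      forceList forcePt g.verts fun V => inside V U) = true := by decide +kernel
  simpa only [forceList_eq forcePt_eq] using h

/-- Together with `sub_mem_kids` this says that the faces of the children are exactly the pieces of
the faces of the parent. In particular a side is cut in the same way from both of its tiles, which
is where the arrows and the directions of unit edges matter. -/
theorem kids_faces_mem : (tileShapes.all fun s => (kids s).all fun c => c.cell.faces.all fun g =>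
    (Shape.tile s).faces.any fun f => f.sub.contains g) = true := by
  have h : (tileShapes.all fun s =>
      forceList forceCell ((Shape.tile s).faces.flatMap Cell.sub) fun A =>
      forceList forceCell ((kids s).flatMap fun c => c.cell.faces) fun B =>
      B.all fun g => A.contains g) = true := by decide +kernel
  simpa only [forceList_eq forceCell_eq, any_contains, List.all_flatMap] using h

theorem sub_mem_kids : (tileShapes.all fun s => (Shape.tile s).faces.all fun f => f.sub.all fun g =>
    (kids s).any fun c => c.cell.faces.contains g) = true := by
  have h : (tileShapes.all fun s =>
      forceList forceCell ((Shape.tile s).faces.flatMap Cell.sub) fun A =>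
      forceList forceCell ((kids s).flatMap fun c => c.cell.faces) fun B =>
      A.all fun g => B.contains g) = true := by decide +kernel
  simpa only [forceList_eq forceCell_eq, any_contains, List.all_flatMap] using h

/-! ### The embedding into the plane and soundness of the tests -/

/-- The embedding of the lattice `ℤ[ζ₈]` into the plane. -/
noncomputable def emb : Pt →+ ℂ where
  toFun x := ⟨x.1 + (x.2.1 - x.2.2.2) * (√2 / 2), x.2.2.1 + (x.2.1 + x.2.2.2) * (√2 / 2)⟩
  map_zero' := by simp [Complex.ext_iff]
  map_add' x y := by
    apply Complex.ext <;> simp <;> ring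

theorem emb_re (x : Pt) : (emb x).re = x.1 + (x.2.1 - x.2.2.2) * (√2 / 2) := rfl

theorem emb_im (x : Pt) : (emb x).im = x.2.2.1 + (x.2.1 + x.2.2.2) * (√2 / 2) := rfl

theorem sqrt_two_mul_self : √2 * √2 = (2 : ℝ) := Real.mul_self_sqrt (by norm_num)

theorem dir_eq_pow (k : ZMod 8) : dir k = (⟨√2 / 2, √2 / 2⟩ : ℂ) ^ k.val := by
  have h : (⟨√2 / 2, √2 / 2⟩ : ℂ) = Complex.exp ((Real.pi / 4 : ℝ) * Complex.I) := by
    rw [Complex.exp_mul_I]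
    apply Complex.ext <;>
      simp only [Complex.add_re, Complex.add_im, Complex.mul_re, Complex.mul_im, Complex.I_re,
        Complex.I_im, ← Complex.ofReal_cos, ← Complex.ofReal_sin, Complex.ofReal_re,
        Complex.ofReal_im, Real.cos_pi_div_four, Real.sin_pi_div_four] <;> ring
  rw [h, ← Complex.exp_nat_mul, dir]
  congr 1
  push_cast
  ring

theorem emb_ldir (k : ZMod 8) : emb (ldir k) = dir k := by
  have h2 := sqrt_two_mul_self
  rw [dir_eq_pow]
  have e2 : (⟨√2 / 2, √2 / 2⟩ : ℂ) ^ 2 = Complex.I := by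
    rw [sq]; apply Complex.ext
    · simp
    · simp; nlinarith
  have e4 : (⟨√2 / 2, √2 / 2⟩ : ℂ) ^ 4 = -1 := by
    rw [show 4 = 2 * 2 by rfl, pow_mul, e2]; simp
  have e3 : (⟨√2 / 2, √2 / 2⟩ : ℂ) ^ 3 = Complex.I * ⟨√2 / 2, √2 / 2⟩ := by
    rw [pow_succ, e2]
  have e5 : (⟨√2 / 2, √2 / 2⟩ : ℂ) ^ 5 = -⟨√2 / 2, √2 / 2⟩ := by
    rw [pow_succ, e4]; simp
  have e6 : (⟨√2 / 2, √2 / 2⟩ : ℂ) ^ 6 = -Complex.I := by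
    rw [show 6 = 4 + 2 by rfl, pow_add, e4, e2]; simp
  have e7 : (⟨√2 / 2, √2 / 2⟩ : ℂ) ^ 7 = -(Complex.I * ⟨√2 / 2, √2 / 2⟩) := by
    rw [show 7 = 4 + 3 by rfl, pow_add, e4, e3]; simp
  fin_cases k
  · show emb (1, 0, 0, 0) = _ ^ 0
    apply Complex.ext <;> simp [emb_re, emb_im]
  · show emb (0, 1, 0, 0) = _ ^ 1
    apply Complex.ext <;> simp [emb_re, emb_im]
  · show emb (0, 0, 1, 0) = _ ^ 2
    rw [e2]; apply Complex.ext <;> simp [emb_re, emb_im]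
  · show emb (0, 0, 0, 1) = _ ^ 3
    rw [e3]; apply Complex.ext <;> simp [emb_re, emb_im]
  · show emb (-1, 0, 0, 0) = _ ^ 4
    rw [e4]; apply Complex.ext <;> simp [emb_re, emb_im]
  · show emb (0, -1, 0, 0) = _ ^ 5
    rw [e5]; apply Complex.ext <;> simp [emb_re, emb_im]
  · show emb (0, 0, -1, 0) = _ ^ 6
    rw [e6]; apply Complex.ext <;> simp [emb_re, emb_im]
  · show emb (0, 0, 0, -1) = _ ^ 7
    rw [e7]; apply Complex.ext <;> simp [emb_re, emb_im]

theorem int_add_mul_sqrt_eq_zero {m n : ℤ} (h : (m : ℝ) + n * √2 = 0) : m = 0 ∧ n = 0 := by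
  have hn : n = 0 := by
    by_contra hn
    refine irrational_sqrt_two ⟨(-m : ℚ) / n, ?_⟩
    have : (n : ℝ) ≠ 0 := by exact_mod_cast hn
    push_cast
    field_simp
    linarith
  subst hn
  simpa using h

/-- The powers 1, ζ, ζ², ζ³ are independent over ℤ because √2 is irrational, so coincidence of
points in the plane can be read off integer coordinates. -/
theorem emb_injective : Function.Injective emb := by
  rw [injective_iff_map_eq_zero]
  rintro ⟨a, b, c, d⟩ h
  have h1 := congrArg Complex.re h
  have h2 := congrArg Complex.im h
  simp only [emb_re, emb_im, Complex.zero_re, Complex.zero_im] at h1 h2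
  have := @int_add_mul_sqrt_eq_zero (2 * a) (b - d) (by push_cast; linarith)
  have := @int_add_mul_sqrt_eq_zero (2 * c) (b + d) (by push_cast; linarith)
  simp only [Prod.mk_eq_zero]
  omega

theorem emb_mulSqrt (x : Pt) : emb (mulSqrt x) = (√2 : ℝ) * emb x := by
  have h2 := sqrt_two_mul_self
  apply Complex.ext
  · simp only [emb_re, mulSqrt, Complex.re_ofReal_mul]
    push_cast
    linear_combination (-(x.2.1 - x.2.2.2) / 2 : ℝ) * h2
  · simp only [emb_im, mulSqrt, Complex.im_ofReal_mul]
    push_cast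
    linear_combination (-(x.2.1 + x.2.2.2) / 2 : ℝ) * h2

theorem emb_mulLam (x : Pt) : emb (mulLam x) = (lam : ℂ) * emb x := by
  rw [mulLam, map_add, emb_mulSqrt, lam]
  push_cast
  ring

theorem lam_pos : 0 < lam := by unfold lam; positivity

/-- The linear form `√2 · Im (z · conj (dir k))`. -/
noncomputable def form (k : ZMod 8) (z : ℂ) : ℝ :=
  √2 * (z * (starRingEnd ℂ) (dir k)).im

theorem form_add (k : ZMod 8) (z w : ℂ) : form k (z + w) = form k z + form k w := by
  simp [form, add_mul]; ring

theorem form_sub (k : ZMod 8) (z w : ℂ) : form k (z - w) = form k z - form k w := by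
  simp [form, sub_mul]; ring

theorem form_real_mul (k : ZMod 8) (r : ℝ) (z : ℂ) : form k (r * z) = r * form k z := by
  rw [form, mul_assoc, Complex.im_ofReal_mul, form]; ring

theorem dir_add_four (k : ZMod 8) : dir (k + 4) = -dir k := by
  rw [← emb_ldir, ← emb_ldir, ← map_neg]
  congr 1
  revert k
  decide

theorem form_add_four (k : ZMod 8) (z : ℂ) : form (k + 4) z = -form k z := by
  simp [form, dir_add_four]; ring

/-- The factor √2 in `form` clears denominators: on the lattice the values are m + n√2 with m, n
integers, whose sign is decided by comparing m² with 2n². -/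
theorem form_emb (k : ZMod 8) (x : Pt) :
    form k (emb x) = (lform k x).1 + (lform k x).2 * √2 := by
  have h2 := sqrt_two_mul_self
  rw [form, ← emb_ldir]
  simp only [Complex.mul_im, Complex.conj_re, Complex.conj_im, emb_re, emb_im]
  obtain ⟨a, b, c, d⟩ := x
  fin_cases k <;>
    simp only [ldir, lform, ZMod.val] <;>
    push_cast
  · linear_combination ((b + d) / 2 : ℝ) * h2
  · linear_combination ((c - a) / 2 + d * √2 / 2: ℝ) * h2
  · linear_combination ((d - b) / 2 : ℝ) * h2
  · linear_combination (-(a + c) / 2 - b * √2 / 2: ℝ) * h2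
  · linear_combination (-(b + d) / 2 : ℝ) * h2
  · linear_combination ((a - c) / 2 - d * √2 / 2: ℝ) * h2
  · linear_combination ((b - d) / 2 : ℝ) * h2
  · linear_combination ((a + c) / 2 + b * √2 / 2: ℝ) * h2

theorem nonneg_sound {a : ℤ × ℤ} (h : nonneg a = true) : 0 ≤ (a.1 : ℝ) + a.2 * √2 := by
  have h2 := sqrt_two_mul_self
  have h0 : 0 ≤ √2 := Real.sqrt_nonneg 2
  obtain ⟨m, n⟩ := a
  simp only [nonneg, Bool.or_eq_true, Bool.and_eq_true, decide_eq_true_eq] at h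
  rcases h with ⟨hm, hn | hn⟩ | ⟨hn, hm⟩
  · have : (0 : ℝ) ≤ m := by exact_mod_cast hm
    have : (0 : ℝ) ≤ n := by exact_mod_cast hn
    positivity
  · have h3 : (0 : ℝ) ≤ m := by exact_mod_cast hm
    have h4 : (2 * (n * n) : ℝ) ≤ m * m := by exact_mod_cast hn
    have := abs_le_of_sq_le_sq' (a := (n : ℝ) * √2) (b := m) (by nlinarith) h3
    linarith
  · have h3 : (0 : ℝ) ≤ n := by exact_mod_cast hn
    have h4 : (m * m : ℝ) ≤ 2 * (n * n) := by exact_mod_cast hm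
    have := abs_le_of_sq_le_sq' (a := (m : ℝ)) (b := n * √2) (by nlinarith) (by positivity)
    linarith

theorem lle_sound {k : ZMod 8} {u v : Pt} (h : lle k u v = true) :
    form k (emb u) ≤ form k (emb v) := by
  have := nonneg_sound h
  rw [← form_emb, map_sub, form_sub] at this
  linarith

theorem leq_iff {k : ZMod 8} {u v : Pt} : leq k u v = true ↔ form k (emb u) = form k (emb v) := by
  have h : form k (emb v) - form k (emb u) = (lform k (v - u)).1 + (lform k (v - u)).2 * √2 := by
    rw [← form_sub, ← map_sub, form_emb]
  rw [leq, beq_iff_eq, Prod.ext_iff, eq_comm (a := form k (emb u)),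
    ← sub_eq_zero (a := form k (emb v)), h]
  refine ⟨fun h => ?_, int_add_mul_sqrt_eq_zero⟩
  simp [h.1, h.2]

theorem llt_sound {k : ZMod 8} {u v : Pt} (h : llt k u v = true) :
    form k (emb u) < form k (emb v) := by
  simp only [llt, Bool.and_eq_true, Bool.not_eq_true', ← Bool.not_eq_true, leq_iff] at h
  exact lt_of_le_of_ne (lle_sound h.1) h.2

theorem mem_dirs (k : ZMod 8) : k ∈ dirs := by revert k; decide

theorem mem_tileShapes (s : TileShape) : s ∈ tileShapes := by
  cases s with
  | rhomb k => revert k; decide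
  | tri h e => revert h e; decide

theorem mem_shapes (s : Shape) : s ∈ shapes := by
  cases s with
  | vert => decide
  | unit k => revert k; decide
  | hyp k => revert k; decide
  | tile s => exact List.mem_append_right _ (List.mem_map_of_mem (mem_tileShapes s))

/-! ### Open cells as point sets -/

/-- The relative interior of the convex hull of `V`, for the polygons `V` considered here, whose
sides have the directions `dir k`. -/
def relint (V : List Pt) : Set ℂ :=
  {w | ∀ k, (∃ v ∈ V, form k w < form k (emb v)) ∨ ∀ v ∈ V, form k w = form k (emb v)}

/-- The convex hull of `V`, for the polygons `V` considered here. -/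
def hull (V : List Pt) : Set ℂ := {w | ∀ k, ∃ v ∈ V, form k w ≤ form k (emb v)}

theorem relint_subset_hull {V : List Pt} (hV : V ≠ []) : relint V ⊆ hull V := by
  intro w hw k
  rcases hw k with ⟨v, hv, h⟩ | h
  · exact ⟨v, hv, h.le⟩
  · exact ⟨V.head hV, V.head_mem hV, (h _ (V.head_mem hV)).le⟩

/-- A common point would lie on the separating line. A relative interior meets a supporting line
only if the whole polygon lies on it, so both polygons would, against the strict pair in `sep`. -/
theorem disjoint_relint_of_sep {V W : List Pt} (h : sep V W = true) :
    Disjoint (relint V) (relint W) := by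
  rw [Set.disjoint_left]
  intro w hV hW
  simp only [sep, List.any_eq_true, List.all_eq_true, Bool.and_eq_true] at h
  obtain ⟨k, -, hle, v, hv, u, hu, hlt⟩ := h
  replace hle := fun a ha b hb => lle_sound (hle a ha b hb)
  replace hlt := llt_sound hlt
  have hW := hW (k + 4)
  simp only [form_add_four, neg_lt_neg_iff, neg_inj] at hW
  rcases hV k with ⟨a, ha, h1⟩ | h1 <;> rcases hW with ⟨b, hb, h2⟩ | h2
  · linarith [hle a ha b hb]
  · linarith [hle a ha u hu, h2 u hu]
  · linarith [hle v hv b hb, h1 v hv]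
  · linarith [h1 v hv, h2 u hu]

theorem relint_subset_of_inside {V U : List Pt} (hV : V ≠ []) (h : inside V U = true) :
    relint V ⊆ relint U := by
  intro w hw k
  simp only [inside, List.any_eq_true, List.all_eq_true, Bool.and_eq_true, Bool.or_eq_true] at h
  rcases h k (mem_dirs k) with ⟨u, hu, hle, v, hv, hlt⟩ | heq
  · left
    refine ⟨u, hu, ?_⟩
    rcases hw k with ⟨a, ha, h1⟩ | h1
    · linarith [lle_sound (hle a ha)]
    · linarith [llt_sound hlt, h1 v hv]
  · rcases hw k with ⟨a, ha, h1⟩ | h1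
    · by_cases hU : ∃ u, u ∈ U
      · obtain ⟨u, hu⟩ := hU
        exact .inl ⟨u, hu, by linarith [leq_iff.1 (heq u hu a ha)]⟩
      · exact .inr fun u hu => (hU ⟨u, hu⟩).elim
    · right
      intro u hu
      rw [leq_iff.1 (heq u hu _ (V.head_mem hV)), h1 _ (V.head_mem hV)]

theorem mem_relint_translate {V : List Pt} {x : Pt} {w : ℂ} :
    w ∈ relint (V.map (x + ·)) ↔ w - emb x ∈ relint V := by
  simp only [relint, Set.mem_ofPred_eq, List.mem_map, exists_exists_and_eq_and,
    forall_exists_index, and_imp, forall_apply_eq_imp_iff₂, map_add, form_add, form_sub,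
    sub_lt_iff_lt_add', sub_eq_iff_eq_add']

theorem mem_hull_translate {V : List Pt} {x : Pt} {w : ℂ} :
    w ∈ hull (V.map (x + ·)) ↔ w - emb x ∈ hull V := by
  simp only [hull, Set.mem_ofPred_eq, List.mem_map, exists_exists_and_eq_and,
    map_add, form_add, form_sub, sub_le_iff_le_add']

theorem mem_relint_mulLam {V : List Pt} {w : ℂ} :
    (lam : ℂ) * w ∈ relint (V.map mulLam) ↔ w ∈ relint V := by
  simp only [relint, Set.mem_ofPred_eq, List.mem_map, exists_exists_and_eq_and,
    forall_exists_index, and_imp, forall_apply_eq_imp_iff₂, emb_mulLam, form_real_mul,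
    mul_lt_mul_iff_right₀ lam_pos, mul_right_inj' lam_pos.ne']

theorem Shape.verts_ne_nil (s : Shape) : s.verts ≠ [] := by
  rcases s with _ | _ | _ | (_ | _) <;> simp [Shape.verts]

/-- The points of an open cell. -/
def Cell.pts (c : Cell) : Set ℂ := relint c.verts

theorem Cell.verts_ne_nil (c : Cell) : c.verts ≠ [] := by
  simp [Cell.verts, Shape.verts_ne_nil]

theorem mem_pts_shift {c : Cell} {x : Pt} {w : ℂ} :
    w ∈ (Cell.pts (shift x c)) ↔ w - emb x ∈ c.pts := by
  rw [Cell.pts, Cell.pts, ← mem_relint_translate, Cell.verts, Cell.verts, List.map_map]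
  congr! 2
  apply List.map_congr_left
  intro v _
  exact add_assoc x c.1 v

theorem mem_pts {c : Cell} {w : ℂ} : w ∈ c.pts ↔ w - emb c.1 ∈ relint c.2.verts :=
  mem_relint_translate

theorem eq_of_pairwiseSep {l : List Cell} (h : pairwiseSep (l.map Cell.verts) = true)
    {c d : Cell} (hc : c ∈ l) (hd : d ∈ l) {w : ℂ} (hwc : w ∈ c.pts) (hwd : w ∈ d.pts) : c = d := by
  induction l with
  | nil => simp at hc
  | cons a l ih =>
    simp only [List.map_cons, pairwiseSep, Bool.and_eq_true, List.all_eq_true,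
      List.forall_mem_map] at h
    rcases List.mem_cons.1 hc with rfl | hc' <;> rcases List.mem_cons.1 hd with rfl | hd'
    · rfl
    · exact (Set.disjoint_left.1 (disjoint_relint_of_sep (h.1 d hd')) hwc hwd).elim
    · exact (Set.disjoint_left.1 (disjoint_relint_of_sep (h.1 c hc')) hwd hwc).elim
    · exact ih h.2 hc' hd'

theorem Cell.mem_sub {c g : Cell} :
    g ∈ c.sub ↔ ∃ d ∈ c.2.sub, shift (mulLam c.1) d = g := List.mem_map

/-- The cells that subdivide an inflated cell lie in it. -/
theorem mem_pts_of_mem_sub {c g : Cell} (hg : g ∈ c.sub) {w : ℂ} (hw : (lam : ℂ) * w ∈ g.pts) :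
    w ∈ c.pts := by
  obtain ⟨d, hd, rfl⟩ := Cell.mem_sub.1 hg
  have := sub_inside
  simp only [List.all_eq_true] at this
  have h1 := relint_subset_of_inside (Cell.verts_ne_nil _) (this c.2 (mem_shapes _) d hd)
  rw [mem_pts_shift, emb_mulLam, ← mul_sub] at hw
  exact mem_pts.2 (mem_relint_mulLam.1 (h1 hw))

/-- The cells that subdivide an inflated cell are disjoint. -/
theorem eq_of_mem_sub {c g g' : Cell} (hg : g ∈ c.sub) (hg' : g' ∈ c.sub) {w : ℂ}
    (hw : w ∈ g.pts) (hw' : w ∈ g'.pts) : g = g' := by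
  obtain ⟨d, hd, rfl⟩ := Cell.mem_sub.1 hg
  obtain ⟨d', hd', rfl⟩ := Cell.mem_sub.1 hg'
  rw [mem_pts_shift] at hw hw'
  have := sub_pairwiseSep
  simp only [List.all_eq_true] at this
  rw [eq_of_pairwiseSep (this c.2 (mem_shapes _)) hd hd' hw hw']

/-! ### Complexes and their inflation -/

/-- The cells of a set of tiles. -/
def cells (X : Set LTile) : Set Cell := {f | ∃ t ∈ X, f ∈ t.cell.faces}

/-- A set of tiles that fit together: cells that overlap are equal. -/
def IsComplex (X : Set LTile) : Prop :=
  ∀ f ∈ cells X, ∀ g ∈ cells X, ∀ w ∈ f.pts, w ∈ g.pts → f = g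

def LTile.children (t : LTile) : List LTile := (kids t.2).map (shift (mulLam t.1))

def lsubst (X : Set LTile) : Set LTile := {c | ∃ t ∈ X, c ∈ t.children}

theorem shift_shift {α : Type} (x y : Pt) (c : Pt × α) : shift x (shift y c) = shift (x + y) c := by
  simp [shift, add_assoc]

theorem shift_zero {α : Type} (c : Pt × α) : shift 0 c = c := by simp [shift]

theorem mulLam_add (x y : Pt) : mulLam (x + y) = mulLam x + mulLam y := by
  apply emb_injective
  simp only [map_add, emb_mulLam, mul_add]

theorem cell_shift (x : Pt) (t : LTile) : LTile.cell (shift x t) = shift x t.cell := rfl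

theorem faces_shift (x : Pt) (c : Cell) : Cell.faces (shift x c) = c.faces.map (shift x) := by
  simp only [Cell.faces, List.map_map]
  apply List.map_congr_left
  intro d _
  exact (shift_shift x c.1 d).symm

theorem sub_shift (x : Pt) (c : Cell) : Cell.sub (shift x c) = c.sub.map (shift (mulLam x)) := by
  simp only [Cell.sub, List.map_map]
  apply List.map_congr_left
  intro d _
  simp only [Function.comp, shift_shift, ← mulLam_add]
  rfl

theorem exists_sub_of_mem_children {t c : LTile} (hc : c ∈ t.children) {g : Cell}
    (hg : g ∈ c.cell.faces) : ∃ f ∈ t.cell.faces, g ∈ f.sub := by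
  obtain ⟨d, hd, rfl⟩ := List.mem_map.1 hc
  rw [cell_shift, faces_shift] at hg
  obtain ⟨g, hg', rfl⟩ := List.mem_map.1 hg
  have := kids_faces_mem
  simp only [List.all_eq_true, List.any_eq_true, List.contains_iff_mem] at this
  obtain ⟨f, hf, hgf⟩ := this t.2 (mem_tileShapes _) d hd g hg'
  refine ⟨shift t.1 f, List.mem_map_of_mem hf, ?_⟩
  rw [sub_shift]
  exact List.mem_map_of_mem hgf

theorem exists_children_of_mem_sub {t : LTile} {f g : Cell} (hf : f ∈ t.cell.faces)
    (hg : g ∈ f.sub) : ∃ c ∈ t.children, g ∈ c.cell.faces := by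
  obtain ⟨f, hf', rfl⟩ := List.mem_map.1 hf
  rw [sub_shift] at hg
  obtain ⟨g, hg', rfl⟩ := List.mem_map.1 hg
  have := sub_mem_kids
  simp only [List.all_eq_true, List.any_eq_true, List.contains_iff_mem] at this
  obtain ⟨c, hc, hgc⟩ := this t.2 (mem_tileShapes _) f hf' g hg'
  refine ⟨shift (mulLam t.1) c, List.mem_map_of_mem hc, ?_⟩
  rw [cell_shift, faces_shift]
  exact List.mem_map_of_mem hgc

/-- Inflation acts on cells rather than tiles. All later arguments about neighbouring tiles rest on
this. -/
theorem mem_cells_lsubst {X : Set LTile} {g : Cell} :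
    g ∈ cells (lsubst X) ↔ ∃ f ∈ cells X, g ∈ f.sub := by
  constructor
  · rintro ⟨c, ⟨t, ht, hc⟩, hg⟩
    obtain ⟨f, hf, h⟩ := exists_sub_of_mem_children hc hg
    exact ⟨f, ⟨t, ht, hf⟩, h⟩
  · rintro ⟨f, ⟨t, ht, hf⟩, hg⟩
    obtain ⟨c, hc, h⟩ := exists_children_of_mem_sub hf hg
    exact ⟨c, ⟨t, ht, hc⟩, h⟩

/-- Two overlapping pieces, scaled back by λ, lie in overlapping cells of X, which are therefore the
same cell; the pieces of a single cell are disjoint. -/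
theorem IsComplex.lsubst {X : Set LTile} (hX : IsComplex X) : IsComplex (lsubst X) := by
  intro g hg g' hg' w hw hw'
  obtain ⟨f, hf, hgf⟩ := mem_cells_lsubst.1 hg
  obtain ⟨f', hf', hgf'⟩ := mem_cells_lsubst.1 hg'
  obtain ⟨v, rfl⟩ : ∃ v, (lam : ℂ) * v = w :=
    ⟨w / lam, mul_div_cancel₀ w (by exact_mod_cast lam_pos.ne')⟩
  have := hX f hf f' hf' v (mem_pts_of_mem_sub hgf hw) (mem_pts_of_mem_sub hgf' hw')
  subst this
  exact eq_of_mem_sub hgf hgf' hw hw'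

theorem isComplex_singleton (t : LTile) : IsComplex {t} := by
  rintro f ⟨t', rfl, hf⟩ g ⟨t, rfl, hg⟩ w hwf hwg
  obtain ⟨f, hf', rfl⟩ := List.mem_map.1 hf
  obtain ⟨g, hg', rfl⟩ := List.mem_map.1 hg
  have := faces_pairwiseSep
  simp only [List.all_eq_true] at this
  rw [mem_pts_shift] at hwf hwg
  rw [eq_of_pairwiseSep (this t.2 (mem_tileShapes _)) hf' hg' hwf hwg]

/-! ### From lattice tiles to tiles in the plane -/

/-- The tile at a lattice position relative to the origin `Q`. -/
noncomputable def place (Q : ℂ) : LTile → Tile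
  | (x, .rhomb k) => .rhomb (Q + emb x) k
  | (x, .tri h e) => .tri (Q + emb x) h e

theorem place_rhomb (Q : ℂ) (x : Pt) (k : Fin 4) :
    place Q (x, .rhomb k) = .rhomb (Q + emb x) k := rfl

theorem place_tri (Q : ℂ) (x : Pt) (h : ZMod 8) (e : Bool) :
    place Q (x, .tri h e) = .tri (Q + emb x) h e := rfl

theorem place_injective (Q : ℂ) : Function.Injective (place Q) := by
  rintro ⟨x, k | ⟨h, e⟩⟩ ⟨x', k' | ⟨h', e'⟩⟩ h
  all_goals simp only [place, Tile.rhomb.injEq, Tile.tri.injEq, add_right_inj, reduceCtorEq] at h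
  · rw [emb_injective h.1, h.2]
  · rw [emb_injective h.1, h.2.1, h.2.2]

theorem place_add (Q : ℂ) (x : Pt) (t : LTile) : place (Q + emb x) t = place Q (shift x t) := by
  obtain ⟨y, k | ⟨h, e⟩⟩ := t <;> simp [place, shift, add_assoc]

theorem exists_place (t : Tile) : ∃ p s, place p (0, s) = t := by
  rcases t with ⟨p, k⟩ | ⟨a, h, e⟩
  · exact ⟨p, .rhomb k, by simp [place]⟩
  · exact ⟨a, .tri h e, by simp [place]⟩

theorem place_lrhomb (Q : ℂ) (x : Pt) (k : ZMod 8) :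
    place Q (lrhomb x k) = mkRhomb (Q + emb x) k := by
  unfold lrhomb mkRhomb
  split_ifs
  · rfl
  · simp only [place, map_add, emb_ldir, add_assoc]

theorem place_lrhombSgn (Q : ℂ) (x : Pt) (k : ZMod 8) (e : Bool) :
    place Q (lrhombSgn x k e) = mkRhombSgn (Q + emb x) k e := by
  cases e <;> exact place_lrhomb _ _ _

theorem children_place (Q : ℂ) (t : LTile) :
    (place Q t).children = t.children.map (place (lam * Q)) := by
  obtain ⟨x, k | ⟨h, e⟩⟩ := t
  · rw [place_rhomb]
    simp only [LTile.children, kids, List.map_cons, List.map_nil, ← place_add, place_lrhomb,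
      place_tri, Tile.children, map_add, emb_ldir, emb_mulLam, map_zero, add_zero, mul_add,
      add_assoc]
  · rw [place_tri]
    simp only [LTile.children, kids, List.map_cons, List.map_nil, ← place_add, place_lrhombSgn,
      place_tri, Tile.children, map_add, emb_ldir, emb_mulLam, mul_add, add_assoc]

theorem subst_image_place (Q : ℂ) (X : Set LTile) :
    subst (place Q '' X) = place (lam * Q) '' lsubst X := by
  ext c
  constructor
  · rintro ⟨_, ⟨t, ht, rfl⟩, hc⟩
    rw [children_place] at hc
    obtain ⟨d, hd, rfl⟩ := List.mem_map.1 hc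
    exact ⟨d, ⟨t, ht, hd⟩, rfl⟩
  · rintro ⟨d, ⟨t, ht, hd⟩, rfl⟩
    refine ⟨place Q t, ⟨t, ht, rfl⟩, ?_⟩
    rw [children_place]
    exact List.mem_map_of_mem hd

theorem corners_place (Q : ℂ) (t : LTile) :
    (place Q t).corners = (fun x => Q + emb x) '' {x | x ∈ t.cell.verts} := by
  obtain ⟨x, k | ⟨h, e⟩⟩ := t <;> ext z <;>
    simp only [place, Tile.corners, LTile.cell, Cell.verts, Shape.verts, List.map_cons,
      List.map_nil, List.mem_cons, List.not_mem_nil, or_false, Set.mem_image, Set.mem_ofPred_eq,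
      Set.mem_insert_iff, Set.mem_singleton_iff, exists_eq_or_imp, exists_eq_left, map_add,
      add_zero, emb_ldir, add_assoc, eq_comm (a := z)]

/-! ### Regions of tiles, their interiors and their open faces -/

theorem convex_hull (V : List Pt) : Convex ℝ (hull V) := by
  intro w hw z hz a b ha hb hab k
  obtain ⟨u, hu, h1⟩ := hw k
  obtain ⟨v, hv, h2⟩ := hz k
  have h3 : form k (a • w + b • z) = a * form k w + b * form k z := by
    rw [form_add, Complex.real_smul, Complex.real_smul, form_real_mul, form_real_mul]
  rw [h3]
  rcases le_total (form k (emb u)) (form k (emb v)) with h | h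
  · refine ⟨v, hv, ?_⟩
    calc _ ≤ a * form k (emb v) + b * form k (emb v) := by gcongr; linarith
      _ = _ := by rw [← add_mul, hab, one_mul]
  · refine ⟨u, hu, ?_⟩
    calc _ ≤ a * form k (emb u) + b * form k (emb u) := by gcongr; linarith
      _ = _ := by rw [← add_mul, hab, one_mul]

/-- A basis expansion with respect to two of the eight directions. -/
theorem form_dir_mul (i j : ZMod 8) (w : ℂ) :
    (form i (dir j) : ℂ) * w = form i w * dir j - form j w * dir i := by
  apply Complex.ext <;> simp [form] <;> ring

theorem form_dir_swap (i j : ZMod 8) : form j (dir i) = -form i (dir j) := by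
  simp [form]; ring

theorem form_dir_self (i : ZMod 8) : form i (dir i) = 0 := by
  simp [form]; ring

theorem form_dir (i j : ZMod 8) :
    form i (dir j) = (lform i (ldir j)).1 + (lform i (ldir j)).2 * √2 := by
  rw [← form_emb, emb_ldir]

theorem exists_coords {i j : ZMod 8} (hD : 0 < form i (dir j)) {w : ℂ}
    (hw : w ∈ hull [0, ldir i, ldir i + ldir j, ldir j]) :
    ∃ a b : ℝ, a ∈ Set.Icc 0 1 ∧ b ∈ Set.Icc 0 1 ∧ w = a * dir i + b * dir j := by
  have h1 := hw i
  have h2 := hw (i + 4)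
  have h3 := hw j
  have h4 := hw (j + 4)
  have h0 : ∀ k, form k 0 = 0 := fun k => by simp [form]
  simp only [List.mem_cons, List.not_mem_nil, or_false, exists_eq_or_imp, exists_eq_left,
    form_add_four, map_add, map_zero, emb_ldir, form_add, form_dir_self, form_dir_swap i j, h0]
    at h1 h2 h3 h4
  set D := form i (dir j)
  refine ⟨-form j w / D, form i w / D, ⟨?_, ?_⟩, ⟨?_, ?_⟩, ?_⟩
  · rw [le_div_iff₀ hD]; rcases h3 with h | h | h | h <;> linarith
  · rw [div_le_iff₀ hD]; rcases h4 with h | h | h | h <;> linarith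
  · rw [le_div_iff₀ hD]; rcases h2 with h | h | h | h <;> linarith
  · rw [div_le_iff₀ hD]; rcases h1 with h | h | h | h <;> linarith
  · have hD' : (D : ℂ) ≠ 0 := by exact_mod_cast hD.ne'
    have := form_dir_mul i j w
    push_cast
    field_simp
    linear_combination this

theorem form_dir_add_one (i : ZMod 8) : form i (dir (i + 1)) = 1 := by
  have : lform i (ldir (i + 1)) = (1, 0) := by revert i; decide
  simp [form_dir, this]

theorem form_dir_add_two (i : ZMod 8) : form i (dir (i + 2)) = √2 := by
  have : lform i (ldir (i + 2)) = (0, 1) := by revert i; decide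
  simp [form_dir, this]

theorem form_dir_add_three (i : ZMod 8) : form i (dir (i + 3)) = 1 := by
  have : lform i (ldir (i + 3)) = (1, 0) := by revert i; decide
  simp [form_dir, this]

theorem exists_coords_tri (i : ZMod 8) {w : ℂ} (hw : w ∈ hull [0, ldir i, ldir (i + 2)]) :
    ∃ a b : ℝ, 0 ≤ a ∧ 0 ≤ b ∧ a + b ≤ 1 ∧ w = a * dir i + b * dir (i + 2) := by
  have h1 : w ∈ hull [0, ldir i, ldir i + ldir (i + 2), ldir (i + 2)] := fun k => by
    obtain ⟨v, hv, h⟩ := hw k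
    exact ⟨v, by simp at hv ⊢; tauto, h⟩
  obtain ⟨a, b, ha, hb, rfl⟩ := exists_coords (by rw [form_dir_add_two]; positivity) h1
  refine ⟨a, b, ha.1, hb.1, ?_, rfl⟩
  -- This form vanishes at the right angle and equals 1 at both ends of the hypotenuse, so it
  -- measures a + b.
  have h3 := hw (i + 7)
  have e1 : form (i + 7) (dir i) = 1 := by
    have := form_dir_add_one (i + 7)
    rwa [add_assoc, show (7 + 1 : ZMod 8) = 0 from rfl, add_zero] at this
  have e2 : form (i + 7) (dir (i + 2)) = 1 := by
    have := form_dir_add_three (i + 7)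
    rwa [add_assoc, show (7 + 3 : ZMod 8) = 2 from rfl] at this
  have h0 : ∀ k, form k 0 = 0 := fun k => by simp [form]
  simp only [List.mem_cons, List.not_mem_nil, or_false, exists_eq_or_imp, exists_eq_left, map_zero,
    emb_ldir, h0, form_add, form_real_mul, e1, e2] at h3
  rcases h3 with h | h | h <;> linarith

theorem mem_convexHull_parallelogram {p u v : ℂ} {a b : ℝ} (ha : a ∈ Set.Icc (0 : ℝ) 1)
    (hb : b ∈ Set.Icc (0 : ℝ) 1) :
    p + (a * u + b * v) ∈ convexHull ℝ {p, p + u, p + u + v, p + v} := by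
  have hc := convex_convexHull ℝ ({p, p + u, p + u + v, p + v} : Set ℂ)
  have hs := subset_convexHull ℝ ({p, p + u, p + u + v, p + v} : Set ℂ)
  have h1 := hc (hs (by simp : p ∈ _)) (hs (by simp : p + u ∈ _)) (sub_nonneg.2 ha.2) ha.1
    (by ring)
  have h2 := hc (hs (by simp : p + v ∈ _)) (hs (by simp : p + u + v ∈ _)) (sub_nonneg.2 ha.2) ha.1
    (by ring)
  have h3 := hc h1 h2 (sub_nonneg.2 hb.2) hb.1 (by ring)
  convert h3 using 1
  simp only [Complex.real_smul]
  push_cast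
  ring

theorem mem_convexHull_triangle {p u v : ℂ} {a b : ℝ} (ha : 0 ≤ a) (hb : 0 ≤ b)
    (hab : a + b ≤ 1) : p + (a * u + b * v) ∈ convexHull ℝ {p, p + u, p + v} := by
  rcases ha.eq_or_lt with rfl | ha'
  · have := (convex_convexHull ℝ ({p, p + u, p + v} : Set ℂ))
      (subset_convexHull ℝ _ (by simp : p ∈ _)) (subset_convexHull ℝ _ (by simp : p + v ∈ _))
      (by linarith : 0 ≤ 1 - b) hb (by ring)
    convert this using 1
    simp only [Complex.real_smul]; push_cast; ring
  · have hc := convex_convexHull ℝ ({p, p + u, p + v} : Set ℂ)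
    have hs := subset_convexHull ℝ ({p, p + u, p + v} : Set ℂ)
    have h1 := hc (hs (by simp : p + u ∈ _)) (hs (by simp : p + v ∈ _))
      (a := a / (a + b)) (b := b / (a + b)) (by positivity) (by positivity) (by field_simp)
    have h2 := hc (hs (by simp : p ∈ _)) h1 (by linarith : 0 ≤ 1 - (a + b))
      (by linarith : 0 ≤ a + b) (by ring)
    convert h2 using 1
    have : (a + b : ℂ) ≠ 0 := by exact_mod_cast (by linarith : a + b ≠ 0)
    simp only [Complex.real_smul]; push_cast; field_simp; ring

theorem hull_congr {V W : List Pt} (h : ∀ v, v ∈ V ↔ v ∈ W) : hull V = hull W := by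
  simp only [hull, h]

theorem convexHull_subset_hull (Q : ℂ) (V : List Pt) :
    convexHull ℝ ((fun x => Q + emb x) '' {x | x ∈ V}) ⊆ (· - Q) ⁻¹' hull V := by
  refine convexHull_min ?_ ?_
  · rintro _ ⟨x, hx, rfl⟩ k
    exact ⟨x, hx, by simp⟩
  · intro w hw z hz a b ha hb hab
    have := convex_hull V hw hz ha hb hab
    have h : a • w + b • z - Q = a • (w - Q) + b • (z - Q) := by
      have : (a + b : ℂ) = 1 := by exact_mod_cast hab
      simp only [Complex.real_smul]
      linear_combination Q * this
    rw [Set.mem_preimage, h]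
    exact this

/-- The region of a tile in terms of linear inequalities. -/
theorem region_place (Q : ℂ) (t : LTile) :
    (place Q t).region = (· - Q) ⁻¹' hull t.cell.verts := by
  rw [Tile.region]
  apply Set.Subset.antisymm
  · rw [corners_place]
    exact convexHull_subset_hull Q _
  intro z hz
  have hz : z - Q - emb t.1 ∈ hull (Shape.tile t.2).verts := mem_hull_translate.1 hz
  obtain ⟨x, k | ⟨h, e⟩⟩ := t
  · obtain ⟨a, b, ha, hb, hab⟩ := exists_coords (by simp [form_dir_add_one]) hz
    have := mem_convexHull_parallelogram (p := Q + emb x) (u := dir k.val) (v := dir (k.val + 1))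
      ha hb
    rw [← hab] at this
    simpa [place, Tile.corners] using this
  · have key : ∀ (i : ZMod 8) (S : Set ℂ), z - Q - emb x ∈ hull [0, ldir i, ldir (i + 2)] →
        S = {Q + emb x, Q + emb x + dir i, Q + emb x + dir (i + 2)} → z ∈ convexHull ℝ S := by
      rintro i S hz rfl
      obtain ⟨a, b, ha, hb, hab, h⟩ := exists_coords_tri i hz
      have := mem_convexHull_triangle (p := Q + emb x) (u := dir i) (v := dir (i + 2)) ha hb hab
      rw [← h] at this
      simpa using this
    cases e
    · refine key (h - 2) _ ?_ ?_
      · rw [sub_add_cancel]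
        refine (hull_congr fun v => ?_).subset hz
        simp only [Shape.verts, sgn, List.mem_cons, List.not_mem_nil, or_false]
        rw [show h + 2 * (if false = true then 1 else -1) = h - 2 by simp; ring]
        tauto
      · simp only [place, Tile.corners, sgn]
        rw [show h + 2 * (if false = true then 1 else -1) = h - 2 by simp; ring, sub_add_cancel,
          Set.pair_comm]
    · refine key h _ ?_ ?_
      · simpa [Shape.verts, sgn] using hz
      · simp [place, Tile.corners, sgn]

/-- The points that lie strictly below some point of `V` in all eight directions. -/
def openHull (V : List Pt) : Set ℂ := {w | ∀ k, ∃ v ∈ V, form k w < form k (emb v)}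

theorem continuous_form (k : ZMod 8) : Continuous (form k) := by
  unfold form
  fun_prop

theorem isOpen_openHull (V : List Pt) : IsOpen (openHull V) := by
  have : openHull V = ⋂ k : ZMod 8, ⋃ v ∈ {v | v ∈ V}, {w | form k w < form k (emb v)} := by
    ext w; simp [openHull]
  rw [this]
  exact isOpen_iInter_of_finite fun k => isOpen_biUnion fun v _ =>
    isOpen_lt (continuous_form k) continuous_const

theorem isClosed_hull (V : List Pt) : IsClosed (hull V) := by
  have : hull V = ⋂ k : ZMod 8, ⋃ v ∈ {v | v ∈ V}, {w | form k w ≤ form k (emb v)} := by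
    ext w; simp [hull]
  rw [this]
  exact isClosed_iInter fun k => (List.finite_toSet V).isClosed_biUnion fun v _ =>
    isClosed_le (continuous_form k) continuous_const

theorem interior_hull (V : List Pt) : interior (hull V) = openHull V := by
  apply Set.Subset.antisymm
  · intro w hw k
    -- A small move at right angles to `dir k`, towards larger values of `form k`, stays in the
    -- hull; so the inequality at w was strict.
    have h1 : Filter.Tendsto (fun t : ℝ => w + t * (Complex.I * dir k)) (nhds 0) (nhds w) := by
      have : Continuous fun t : ℝ => w + t * (Complex.I * dir k) := by fun_prop
      simpa using this.tendsto 0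
    obtain ⟨t, ht, ht'⟩ := (((h1.eventually (mem_interior_iff_mem_nhds.1 hw)).filter_mono
      (nhdsWithin_le_nhds (s := Set.Ioi 0))).and self_mem_nhdsWithin).exists
    obtain ⟨v, hv, h⟩ := ht k
    refine ⟨v, hv, ?_⟩
    have hpos : 0 < form k (Complex.I * dir k) := by
      have h0 : dir k ≠ 0 := Complex.exp_ne_zero _
      have : form k (Complex.I * dir k) = √2 * Complex.normSq (dir k) := by
        rw [form, mul_assoc, Complex.mul_conj]; simp
      rw [this]
      have := Complex.normSq_pos.2 h0
      positivity
    rw [form_add, form_real_mul] at h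
    have : 0 < t * form k (Complex.I * dir k) := mul_pos ht' hpos
    linarith
  · refine interior_maximal (fun w hw k => ?_) (isOpen_openHull V)
    obtain ⟨v, hv, h⟩ := hw k
    exact ⟨v, hv, h.le⟩

theorem interior_preimage_sub (Q : ℂ) (s : Set ℂ) :
    interior ((· - Q) ⁻¹' s) = (· - Q) ⁻¹' interior s :=
  ((Homeomorph.subRight Q).preimage_interior s).symm

/-- A test for `V` not to lie on a line of one of the eight directions. -/
def fat (V : List Pt) : Bool := dirs.all fun k => V.any fun u => V.any fun v => llt k u v

theorem fat_tile : (tileShapes.all fun s => fat (Shape.tile s).verts) = true := by decide +kernel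

theorem relint_of_fat {V : List Pt} (h : fat V = true) : relint V = openHull V := by
  ext w
  refine ⟨fun hw k => (hw k).resolve_right fun hk => ?_, fun hw k => .inl (hw k)⟩
  simp only [fat, List.all_eq_true, List.any_eq_true] at h
  obtain ⟨u, hu, v, hv, huv⟩ := h k (mem_dirs k)
  linarith [llt_sound huv, hk u hu, hk v hv]

theorem openHull_translate {V : List Pt} {x : Pt} {w : ℂ} :
    w ∈ openHull (V.map (x + ·)) ↔ w - emb x ∈ openHull V := by
  simp only [openHull, Set.mem_ofPred_eq, List.mem_map, exists_exists_and_eq_and,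
    map_add, form_add, form_sub, sub_lt_iff_lt_add']

theorem interior_region_place (Q : ℂ) (t : LTile) :
    interior (place Q t).region = (· - Q) ⁻¹' t.cell.pts := by
  rw [region_place, interior_preimage_sub, interior_hull]
  ext z
  have := fat_tile
  simp only [List.all_eq_true] at this
  simp only [Set.mem_preimage]
  rw [mem_pts, LTile.cell, relint_of_fat (this t.2 (mem_tileShapes _)), ← openHull_translate]
  rfl

/-- Keep the vertices of positive weight in a convex combination. The value of a linear form at the
point is then a weighted average with positive weights: strictly below the maximum unless the form
is constant on those vertices. With `subset_faces` this puts every point of a tile in one of its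
open faces. -/
theorem exists_mem_relint_filter {V : List Pt} {Q z : ℂ}
    (hz : z ∈ convexHull ℝ ((fun x => Q + emb x) '' {x | x ∈ V})) :
    ∃ p : Pt → Bool, V.filter p ≠ [] ∧ z - Q ∈ relint (V.filter p) := by
  classical
  have : ((fun x => Q + emb x) '' {x | x ∈ V}) = (V.toFinset.image (fun x => Q + emb x) : Set ℂ) := by
    ext; simp
  rw [this, Finset.mem_convexHull'] at hz
  obtain ⟨c, h0, h1, rfl⟩ := hz
  have hinj : Set.InjOn (fun x => Q + emb x) V.toFinset := fun x _ y _ h =>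
    emb_injective (add_left_cancel h)
  rw [Finset.sum_image hinj] at h1
  rw [Finset.sum_image hinj]
  simp only [Finset.mem_image, List.mem_toFinset, forall_exists_index, and_imp,
    forall_apply_eq_imp_iff₂] at h0
  set d : Pt → ℝ := fun x => c (Q + emb x)
  replace h0 : ∀ x ∈ V, 0 ≤ d x := h0
  have hQ : ∑ x ∈ V.toFinset, d x • (Q + emb x) - Q = ∑ x ∈ V.toFinset, (d x : ℂ) * emb x := by
    rw [Finset.sum_congr rfl fun x _ => smul_add (d x) Q (emb x), Finset.sum_add_distrib,
      ← Finset.sum_smul, h1, one_smul, add_sub_cancel_left]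
    simp only [Complex.real_smul]
  have hform : ∀ k, form k (∑ x ∈ V.toFinset, (d x : ℂ) * emb x) =
      ∑ x ∈ V.toFinset, d x * form k (emb x) := fun k => by
    let F : ℂ →+ ℝ := AddMonoidHom.mk' (form k) (form_add k)
    have : form k (∑ x ∈ V.toFinset, (d x : ℂ) * emb x) = F (∑ x ∈ V.toFinset, (d x : ℂ) * emb x) :=
      rfl
    rw [this, map_sum]
    exact Finset.sum_congr rfl fun x _ => form_real_mul _ _ _
  refine ⟨fun x => decide (0 < d x), fun hnil => ?_, fun k => ?_⟩
  · rw [List.filter_eq_nil_iff] at hnil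
    have : ∑ x ∈ V.toFinset, d x ≤ 0 := Finset.sum_nonpos fun x hx => by
      simpa using hnil x (List.mem_toFinset.1 hx)
    linarith
  · rw [hQ]
    simp only [List.mem_filter, decide_eq_true_eq]
    set r := form k (∑ x ∈ V.toFinset, (d x : ℂ) * emb x) with hr
    by_contra! hcon
    obtain ⟨hle, v, ⟨hv, hdv⟩, hne⟩ := hcon
    have hsum : ∑ x ∈ V.toFinset, d x * (r - form k (emb x)) = 0 := by
      simp only [mul_sub, Finset.sum_sub_distrib, ← Finset.sum_mul]
      rw [h1, ← hform, ← hr]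
      ring
    have hnn : ∀ x ∈ V.toFinset, 0 ≤ d x * (r - form k (emb x)) := fun x hx => by
      have hx := List.mem_toFinset.1 hx
      rcases (h0 x hx).eq_or_lt with h | h
      · rw [← h, zero_mul]
      · exact mul_nonneg (h0 x hx) (sub_nonneg.2 (hle x ⟨hx, h⟩))
    have := (Finset.sum_eq_zero_iff_of_nonneg hnn).1 hsum v (List.mem_toFinset.2 hv)
    rcases mul_eq_zero.1 this with h | h
    · linarith
    · exact hne (sub_eq_zero.1 h)

theorem subset_faces : (tileShapes.all fun s => (Shape.tile s).verts.sublists.all fun A =>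
    A.isEmpty || (Shape.tile s).faces.any fun f => inside A f.verts) = true := by
  have h : (tileShapes.all fun s =>
      forceList (forceList forcePt) (Shape.tile s).verts.sublists fun L =>
      forceList (forceList forcePt) ((Shape.tile s).faces.map Cell.verts) fun M =>
      L.all fun A => A.isEmpty || M.any fun U => inside A U) = true := by decide +kernel
  simpa only [forceList_eq (forceList_eq forcePt_eq), List.any_map, Function.comp_def] using h

theorem verts_faces_subset : (tileShapes.all fun s => (Shape.tile s).faces.all fun f =>
    f.verts.all fun v => (Shape.tile s).verts.contains v) = true := by decide +kernel

theorem map_filter_shift {V : List Pt} (x : Pt) (p : Pt → Bool) :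
    (V.map (x + ·)).filter p = (V.filter (p ∘ (x + ·))).map (x + ·) := List.filter_map

/-- A tile is the union of its open faces. -/
theorem mem_region_place {Q z : ℂ} {t : LTile} :
    z ∈ (place Q t).region ↔ ∃ f ∈ t.cell.faces, z - Q ∈ f.pts := by
  constructor
  · intro hz
    rw [Tile.region, corners_place] at hz
    obtain ⟨p, hp, hz⟩ := exists_mem_relint_filter hz
    rw [Cell.verts, map_filter_shift] at hz hp
    have := subset_faces
    simp only [List.all_eq_true, List.any_eq_true, Bool.or_eq_true, List.isEmpty_iff,
      List.mem_sublists] at this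
    have hp' : (Shape.tile t.2).verts.filter (p ∘ (t.1 + ·)) ≠ [] := fun h =>
      hp (by rw [show t.cell.2.verts.filter (p ∘ (t.cell.1 + ·)) = [] from h, List.map_nil])
    obtain ⟨f, hf, h⟩ := (this t.2 (mem_tileShapes _) _ List.filter_sublist).resolve_left hp'
    refine ⟨shift t.1 f, List.mem_map_of_mem hf, ?_⟩
    rw [mem_pts_shift]
    exact relint_subset_of_inside hp' h (mem_relint_translate.1 hz)
  · rintro ⟨f, hf, hz⟩
    obtain ⟨g, hg, rfl⟩ := List.mem_map.1 hf
    rw [region_place]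
    refine mem_hull_translate.2 ?_
    rw [mem_pts_shift] at hz
    intro k
    obtain ⟨v, hv, h⟩ := relint_subset_hull (Cell.verts_ne_nil _) hz k
    have := verts_faces_subset
    simp only [List.all_eq_true, List.contains_iff_mem] at this
    exact ⟨v, this t.2 (mem_tileShapes _) g hg v hv, h⟩

theorem mem_pts_vert {x : Pt} {w : ℂ} : w ∈ Cell.pts (x, .vert) ↔ w = emb x := by
  rw [mem_pts, ← sub_eq_zero (a := w)]
  set v := w - emb x
  have h0 : ∀ k, form k 0 = 0 := fun k => by simp [form]
  simp only [relint, Shape.verts, List.mem_singleton, exists_eq_left, forall_eq, map_zero, h0,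
    Set.mem_ofPred_eq]
  refine ⟨fun h => ?_, fun h k => .inr (h ▸ h0 k)⟩
  have h1 : ∀ k, form k v = 0 := fun k => by
    have h2 := h (k + 4)
    rw [form_add_four] at h2
    rcases h k with h | h <;> rcases h2 with h2 | h2 <;> linarith
  have := form_dir_mul 0 2 v
  rw [h1, h1, show (2 : ZMod 8) = 0 + 2 by rfl, form_dir_add_two] at this
  have h2 : ((√2 : ℝ) : ℂ) ≠ 0 := by exact_mod_cast (by positivity : √2 ≠ 0)
  simpa [h2] using this

theorem lam_mul_div (w : ℂ) : (lam : ℂ) * (w / lam) = w :=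
  mul_div_cancel₀ w (by exact_mod_cast lam_pos.ne')

/-- The dissection of an open inflated tile contains a vertex; divided by λ, it is a point of the
open tile. -/
theorem tile_pts_nonempty (t : LTile) : (t.cell.pts).Nonempty := by
  obtain ⟨y, hy⟩ : ∃ y, (y, Shape.vert) ∈ (Shape.tile t.2).sub := by
    rcases t.2 with k | ⟨h, e⟩
    · exact ⟨_, List.mem_append_right _ List.mem_cons_self⟩
    · exact ⟨_, List.mem_append_right _ List.mem_cons_self⟩
  have : shift (mulLam t.1) (y, Shape.vert) ∈ t.cell.sub := List.mem_map_of_mem hy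
  refine ⟨_, mem_pts_of_mem_sub this (w := emb (mulLam t.1 + y) / lam) ?_⟩
  rw [lam_mul_div]
  exact mem_pts_vert.2 rfl

theorem cell_mem_faces (c : Cell) : c ∈ c.faces :=
  List.mem_map.2 ⟨(0, c.2), List.mem_cons_self, by simp [shift]⟩

theorem boundary_ne_tile (s : Shape) : ∀ f ∈ s.boundary, ∀ r, f.2 ≠ .tile r := by
  rcases s with _ | _ | _ | (k | ⟨h, e⟩) <;>
    simp [Shape.boundary, Shape.verts, TileShape.edges]

theorem eq_of_cell_mem_faces {t t' : LTile} (h : t.cell ∈ t'.cell.faces) : t = t' := by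
  obtain ⟨d, hd, hdt⟩ := List.mem_map.1 h
  rcases List.mem_cons.1 hd with rfl | hd
  · simp only [shift, LTile.cell, add_zero, Prod.mk.injEq, Shape.tile.injEq] at hdt
    exact Prod.ext hdt.1.symm hdt.2.symm
  · exact (boundary_ne_tile _ d hd t.2 (congrArg Prod.snd hdt)).elim

theorem cell_mem_cells {X : Set LTile} {t : LTile} (ht : t ∈ X) : t.cell ∈ cells X :=
  ⟨t, ht, cell_mem_faces _⟩

/-- The interior of t is an open cell, so the open face of t' through z must be that very cell, and
a tile is a face only of itself. -/
theorem IsComplex.eq_of_mem {X : Set LTile} (hX : IsComplex X) {Q z : ℂ} {t t' : LTile}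
    (ht : t ∈ X) (ht' : t' ∈ X) (hz : z ∈ interior (place Q t).region)
    (hz' : z ∈ (place Q t').region) : t = t' := by
  rw [interior_region_place] at hz
  obtain ⟨f, hf, hzf⟩ := mem_region_place.1 hz'
  have := hX _ (cell_mem_cells ht) f ⟨t', ht', hf⟩ _ hz hzf
  exact eq_of_cell_mem_faces (this ▸ hf)

/-! ### Inflated tiles as packings; every Ammann–Beenker tiling is an inflation -/

theorem iterate_subst_place (n : ℕ) (p : ℂ) (s : TileShape) :
    subst^[n] {place p (0, s)} = place ((lam : ℂ) ^ n * p) '' lsubst^[n] {(0, s)} := by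
  induction n with
  | zero => simp
  | succ n ih =>
    rw [Function.iterate_succ_apply', ih, subst_image_place, Function.iterate_succ_apply', ← mul_assoc,
      pow_succ']

theorem isComplex_iterate (n : ℕ) (t : LTile) : IsComplex (lsubst^[n] {t}) := by
  induction n with
  | zero => exact isComplex_singleton t
  | succ n ih => rw [Function.iterate_succ_apply']; exact ih.lsubst

/-- The inflations of a tile are packings. -/
theorem eq_of_mem_iterate_subst {n : ℕ} {t a b : Tile} (ha : a ∈ subst^[n] {t})
    (hb : b ∈ subst^[n] {t}) {z : ℂ} (hza : z ∈ interior a.region) (hzb : z ∈ b.region) :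
    a = b := by
  obtain ⟨p, s, rfl⟩ := exists_place t
  rw [iterate_subst_place] at ha hb
  obtain ⟨a, ha, rfl⟩ := ha
  obtain ⟨b, hb, rfl⟩ := hb
  rw [(isComplex_iterate n _).eq_of_mem ha hb hza hzb]

theorem interior_region_nonempty (t : Tile) : (interior t.region).Nonempty := by
  obtain ⟨p, s, rfl⟩ := exists_place t
  obtain ⟨w, hw⟩ := tile_pts_nonempty (0, s)
  rw [interior_region_place]
  exact ⟨w + p, by simpa using hw⟩

/-- A parent is determined by its shape and by which of its children the given tile is. -/
theorem finite_parents (c : Tile) : {q : Tile | c ∈ q.children}.Finite := by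
  obtain ⟨p, r, rfl⟩ := exists_place c
  have : {q : Tile | place p (0, r) ∈ q.children} ⊆
      ⋃ s ∈ {s | s ∈ tileShapes}, ⋃ d ∈ {d | d ∈ kids s}, {place ((p - emb d.1) / lam) (0, s)} := by
    intro q hq
    obtain ⟨q, s, rfl⟩ := exists_place q
    rw [Set.mem_ofPred_eq, children_place] at hq
    obtain ⟨d, hd, h⟩ := List.mem_map.1 hq
    obtain ⟨d, hd', rfl⟩ := List.mem_map.1 hd
    have h0 : mulLam 0 = 0 := rfl
    rw [h0, shift_zero] at h
    simp only [Set.mem_iUnion, Set.mem_singleton_iff]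
    refine ⟨s, mem_tileShapes s, d, hd', ?_⟩
    have hp : p = lam * q + emb d.1 := by
      obtain ⟨x, k | ⟨e, b⟩⟩ := d <;> rcases r with k' | ⟨e', b'⟩ <;>
        simp [place] at h <;> simp [h]
    have h1 : (lam : ℂ) ≠ 0 := by exact_mod_cast lam_pos.ne'
    rw [hp, add_sub_cancel_right, mul_div_cancel_left₀ _ h1]
  refine Set.Finite.subset ?_ this
  exact (List.finite_toSet _).biUnion fun s _ => (List.finite_toSet _).biUnion fun d _ =>
    Set.finite_singleton _

theorem exists_lam_mul_mem_region {t c : Tile} (hc : c ∈ t.children) {z : ℂ}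
    (hz : (lam : ℂ) * z ∈ c.region) : z ∈ t.region := by
  obtain ⟨p, s, rfl⟩ := exists_place t
  rw [children_place] at hc
  obtain ⟨c, hc', rfl⟩ := List.mem_map.1 hc
  obtain ⟨g, hg, hz⟩ := mem_region_place.1 hz
  rw [← mul_sub] at hz
  obtain ⟨f, hf, hgf⟩ := exists_sub_of_mem_children hc' hg
  exact mem_region_place.2 ⟨f, hf, mem_pts_of_mem_sub hgf hz⟩

theorem isCompact_region (t : Tile) : IsCompact t.region := by
  obtain ⟨p, s, rfl⟩ := exists_place t
  rw [Tile.region, corners_place]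
  exact ((List.finite_toSet _).image _).isCompact_convexHull ℝ

theorem IsTiling.nontrivial {T : Set Tile} (hT : IsTiling T) : T.Nontrivial := by
  by_contra h
  rw [Set.not_nontrivial_iff] at h
  refine noncompact_univ ℂ ?_
  rw [← hT.1]
  exact h.finite.isCompact_biUnion fun t _ => isCompact_region t

/-- Every Ammann–Beenker tiling is the inflation of one. -/
theorem IsAmmannBeenker.exists_subst_eq {T : Set Tile} (hT : IsAmmannBeenker T) :
    ∃ S, IsAmmannBeenker S ∧ subst S = T := by
  -- Two different tiles are fixed so that a patch containing both cannot lie in a zero-fold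
  -- inflation, that is, in a single tile.
  obtain ⟨c₀, hc₀, c₁, hc₁, hne⟩ := hT.1.nontrivial
  have key : ∀ P : Finset T, ∃ (m : ℕ) (t : Tile), ⟨c₀, hc₀⟩ ∈ P → ⟨c₁, hc₁⟩ ∈ P →
      ∀ c ∈ P, (c : Tile) ∈ subst^[m + 1] {t} := by
    intro P
    obtain ⟨n, t, h⟩ := hT.2 (Subtype.val '' (P : Set T)) (P.finite_toSet.image _)
      (by rintro _ ⟨c, -, rfl⟩; exact c.2)
    have h' : ∀ c ∈ P, (c : Tile) ∈ subst^[n] {t} := fun c hc => h ⟨c, hc, rfl⟩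
    rcases n with _ | n
    · refine ⟨0, t, fun h0 h1 => (hne ?_).elim⟩
      have e0 : c₀ = t := h' _ h0
      have e1 : c₁ = t := h' _ h1
      rw [e0, e1]
    · exact ⟨n, t, fun _ _ => h'⟩
  choose m t hmt using key
  -- The ultrafilter contains, for each tile of T, the family of finite patches that include it.
  let U : Ultrafilter (Finset T) := Ultrafilter.of Filter.atTop
  have hU : ∀ c : T, ∀ᶠ P in (U : Filter (Finset T)), c ∈ P := fun c =>
    (Ultrafilter.of_le _) ((Filter.eventually_ge_atTop {c}).mono fun P hP => hP (by simp))
  have hP : ∀ᶠ P in (U : Filter (Finset T)), ∀ c ∈ P, (c : Tile) ∈ subst^[m P + 1] {t P} := by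
    filter_upwards [hU ⟨c₀, hc₀⟩, hU ⟨c₁, hc₁⟩] with P h0 h1 using hmt P h0 h1
  have hev : ∀ c ∈ T, ∀ᶠ P in (U : Filter (Finset T)), c ∈ subst^[m P + 1] {t P} := fun c hc => by
    filter_upwards [hP, hU ⟨c, hc⟩] with P h h1 using h _ h1
  let S : Set Tile := {q | ∀ᶠ P in (U : Filter (Finset T)), q ∈ subst^[m P] {t P}}
  have hTS : ∀ c ∈ T, ∃ q ∈ S, c ∈ q.children := by
    intro c hc
    have h1 : ∀ᶠ P in (U : Filter (Finset T)),
        ∃ q ∈ {q : Tile | c ∈ q.children}, q ∈ subst^[m P] {t P} := by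
      filter_upwards [hev c hc] with P h
      rw [Function.iterate_succ_apply'] at h
      obtain ⟨q, hq, hcq⟩ := h
      exact ⟨q, hcq, hq⟩
    -- Among finitely many candidate parents, an ultrafilter selects one that is present for almost
    -- all patches.
    obtain ⟨q, hq, h2⟩ := (Ultrafilter.eventually_exists_mem_iff (finite_parents c)).1 h1
    exact ⟨q, h2, hq⟩
  refine ⟨S, ⟨⟨?_, ?_⟩, ?_⟩, Set.Subset.antisymm ?_ hTS⟩
  · refine Set.eq_univ_of_forall fun z => ?_
    have hz : (lam : ℂ) * z ∈ ⋃ t ∈ T, t.region := hT.1.1 ▸ Set.mem_univ _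
    simp only [Set.mem_iUnion] at hz ⊢
    obtain ⟨c, hc, hzc⟩ := hz
    obtain ⟨q, hq, hcq⟩ := hTS c hc
    exact ⟨q, hq, exists_lam_mul_mem_region hcq hzc⟩
  · intro a ha b hb hab
    obtain ⟨P, ha, hb⟩ := (ha.and hb).exists
    rw [Set.disjoint_left]
    exact fun z hza hzb => hab (eq_of_mem_iterate_subst ha hb hza (interior_subset hzb))
  · intro P hPf hPS
    have : ∀ᶠ P' in (U : Filter (Finset T)), ∀ q ∈ P, q ∈ subst^[m P'] {t P'} :=
      (Filter.eventually_all_finite hPf).2 fun q hq => hPS hq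
    obtain ⟨P', h⟩ := this.exists
    exact ⟨m P', t P', h⟩
  · rintro c ⟨q, hq, hcq⟩
    -- An interior point of c lies in some tile d of T. For a suitable patch c and d belong to one
    -- inflated tile, which is a packing, so c = d.
    obtain ⟨z, hz⟩ := interior_region_nonempty c
    have hz' : z ∈ ⋃ t ∈ T, t.region := hT.1.1 ▸ Set.mem_univ _
    simp only [Set.mem_iUnion] at hz'
    obtain ⟨d, hd, hzd⟩ := hz'
    obtain ⟨P, hq, hd'⟩ := (Filter.Eventually.and hq (hev d hd)).exists
    have hc : c ∈ subst^[m P + 1] {t P} := by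
      rw [Function.iterate_succ_apply']
      exact ⟨q, hq, hcq⟩
    rwa [eq_of_mem_iterate_subst hc hd' hz hzd]

/-- An Ammann–Beenker tiling has its vertices in a translate of the lattice, and its tiles fit
together. -/
theorem IsAmmannBeenker.exists_place {T : Set Tile} (hT : IsAmmannBeenker T) :
    ∃ Q X, T = place Q '' X ∧ IsComplex X := by
  obtain ⟨c₀, hc₀⟩ := hT.1.nontrivial.nonempty
  obtain ⟨Q, s₀, rfl⟩ := AmmannBeenker.exists_place c₀
  have key : ∀ P ⊆ T, P.Finite → ∃ Y x, IsComplex Y ∧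
      ∀ c ∈ P, ∃ d, shift x d ∈ Y ∧ place Q d = c := by
    intro P hP hPf
    -- The base tile is added to the patch so that the lattice of the inflated tile can be aligned
    -- with Q: its position x there is the required shift.
    obtain ⟨n, t, h⟩ := hT.2 (insert (place Q (0, s₀)) P) (hPf.insert _)
      (Set.insert_subset hc₀ hP)
    obtain ⟨p, s, rfl⟩ := AmmannBeenker.exists_place t
    rw [iterate_subst_place] at h
    obtain ⟨⟨x, r⟩, -, hx⟩ := h (Set.mem_insert _ _)
    have hQ : Q = lam ^ n * p + emb x := by
      rcases s₀ with k | ⟨e, b⟩ <;> rcases r with k' | ⟨e', b'⟩ <;>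
        simp [place] at hx <;> simp [hx]
    refine ⟨_, x, isComplex_iterate n (0, s), fun c hc => ?_⟩
    obtain ⟨d, hd, rfl⟩ := h (Set.mem_insert_of_mem _ hc)
    refine ⟨shift (-x) d, ?_, ?_⟩
    · rwa [shift_shift, add_neg_cancel, shift_zero]
    · rw [hQ, place_add, shift_shift, add_neg_cancel, shift_zero]
  refine ⟨Q, {d | place Q d ∈ T}, ?_, ?_⟩
  · ext c
    constructor
    · intro hc
      obtain ⟨Y, x, -, h⟩ := key {c} (by simpa using hc) (Set.finite_singleton c)
      obtain ⟨d, -, rfl⟩ := h c rfl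
      exact ⟨d, hc, rfl⟩
    · rintro ⟨d, hd, rfl⟩
      exact hd
  · rintro f ⟨a, ha, hf⟩ g ⟨b, hb, hg⟩ w hwf hwg
    obtain ⟨Y, x, hY, h⟩ := key {place Q a, place Q b}
      (by rintro _ (rfl | rfl); exacts [ha, hb]) (Set.toFinite _)
    obtain ⟨a', ha', haa⟩ := h _ (.inl rfl)
    obtain ⟨b', hb', hbb⟩ := h _ (.inr rfl)
    rw [place_injective Q haa] at ha'
    rw [place_injective Q hbb] at hb'
    have := hY (shift x f) ⟨_, ha', by rw [cell_shift, faces_shift]; exact List.mem_map_of_mem hf⟩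
      (shift x g) ⟨_, hb', by rw [cell_shift, faces_shift]; exact List.mem_map_of_mem hg⟩
      (w + emb x) (by simpa [mem_pts_shift] using hwf) (by simpa [mem_pts_shift] using hwg)
    simpa [shift, Prod.ext_iff] using this

/-! ### Local finiteness and neighbours across a boundary point -/

open MeasureTheory in
theorem IsComplex.finite_meets_ball {X : Set LTile} (hX : IsComplex X) (Q m : ℂ) :
    {t ∈ X | ((place Q t).region ∩ Metric.closedBall m 1).Nonempty}.Finite := by
  have hs : ∀ s ∈ {s | s ∈ tileShapes},
      {x : Pt | (x, s) ∈ X ∧ ((place Q (x, s)).region ∩ Metric.closedBall m 1).Nonempty}.Finite := by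
    intro s _
    set A := {x : Pt | (x, s) ∈ X ∧
      ((place Q (x, s)).region ∩ Metric.closedBall m 1).Nonempty} with hA
    have htrans : ∀ x z, z ∈ (place Q (x, s)).region ↔ z - (Q + emb x) ∈
        (place 0 (0, s)).region := by
      intro x z
      rw [region_place, region_place]
      show z - Q ∈ hull _ ↔ z - (Q + emb x) - 0 ∈ hull _
      rw [LTile.cell, LTile.cell, Cell.verts, Cell.verts, mem_hull_translate, mem_hull_translate]
      simp only [map_zero, sub_zero, sub_sub]
    obtain ⟨R, hR⟩ := (isCompact_region (place 0 (0, s))).isBounded.subset_closedBall 0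
    have hopen : IsOpen (Cell.pts (0, .tile s)) := by
      have := interior_region_place 0 (0, s)
      simp only [sub_zero, Set.preimage_id'] at this
      exact this ▸ isOpen_interior
    -- Tiles of one shape have disjoint interiors of equal positive area, and those that meet the
    -- unit ball about m lie within R + R + 1 of m; hence they are finite in number.
    have hfin := Measure.finite_const_le_meas_of_disjoint_iUnion (volume : Measure ℂ)
      (ε := volume (Cell.pts (0, .tile s)))
      (hopen.measure_pos _ (tile_pts_nonempty (0, s)))
      (As := fun x : A => interior (place Q (x.1, s)).region)
      (fun x => isOpen_interior.measurableSet) ?_ ?_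
    · have huniv : {i : A | volume (Cell.pts (0, .tile s)) ≤
          volume (interior (place Q (i.1, s)).region)} = Set.univ := by
        refine Set.eq_univ_of_forall fun x => ?_
        have : interior (place Q (x.1, s)).region =
            (fun z => z - (Q + emb x.1)) ⁻¹' Cell.pts (0, .tile s) := by
          rw [interior_region_place]
          ext z
          simp only [Set.mem_preimage, mem_pts, LTile.cell, map_zero, sub_zero, sub_sub]
        rw [Set.mem_ofPred_eq, this, (measurePreserving_sub_right volume (Q + emb x.1)).measure_preimage
          hopen.measurableSet.nullMeasurableSet]
      rw [huniv, Set.finite_univ_iff] at hfin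
      exact hfin
    · intro x y hxy
      rw [Function.onFun, Set.disjoint_left]
      intro z hz hz'
      have := hX.eq_of_mem x.2.1 y.2.1 hz (interior_subset hz')
      exact hxy (Subtype.ext (congrArg Prod.fst this))
    · refine ((measure_mono ?_).trans_lt
        (Metric.isBounded_closedBall (x := m) (r := R + R + 1)).measure_lt_top).ne
      refine Set.iUnion_subset fun x z hz => ?_
      obtain ⟨y, hy, hym⟩ := x.2.2
      have h1 := hR ((htrans _ _).1 (interior_subset hz))
      have h2 := hR ((htrans _ _).1 hy)
      rw [mem_closedBall_zero_iff] at h1 h2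
      rw [Metric.mem_closedBall, dist_eq_norm] at hym ⊢
      have : z - m = (z - (Q + emb x)) - (y - (Q + emb x)) + (y - m) := by ring
      rw [this]
      exact (norm_add_le _ _).trans (add_le_add ((norm_sub_le _ _).trans (add_le_add h1 h2)) hym)
  refine (((List.finite_toSet tileShapes).biUnion fun s h => (hs s h).image fun x => (x, s))).subset ?_
  rintro ⟨x, s⟩ ⟨hx, h⟩
  simp only [Set.mem_iUnion]
  exact ⟨s, mem_tileShapes s, x, ⟨hx, h⟩, rfl⟩

/-- Across each boundary point of a tile there is another tile. -/
theorem IsComplex.exists_ne_mem_region {X : Set LTile} (hX : IsComplex X) {Q : ℂ}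
    (hcov : (⋃ t ∈ place Q '' X, t.region) = Set.univ) {t : LTile} {m : ℂ}
    (hm : m ∉ interior (place Q t).region) : ∃ t' ∈ X, t' ≠ t ∧ m ∈ (place Q t').region := by
  by_contra! hcon
  set F := {t ∈ X | ((place Q t).region ∩ Metric.closedBall m 1).Nonempty} \ {t} with hF
  have hfin : F.Finite := (hX.finite_meets_ball Q m).sdiff
  have hC : IsClosed (⋃ t' ∈ F, (place Q t').region) :=
    hfin.isClosed_biUnion fun t' _ => (isCompact_region _).isClosed
  -- If m lay in no other tile, then, the finitely many others near m being closed, a neighbourhood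
  -- of m would be covered by t alone and m would be interior.
  refine hm (interior_maximal (t := Metric.ball m 1 ∩ (⋃ t' ∈ F, (place Q t').region)ᶜ) ?_
    (Metric.isOpen_ball.inter hC.isOpen_compl) ⟨Metric.mem_ball_self one_pos, ?_⟩)
  · rintro z ⟨hz, hzC⟩
    have hz' : z ∈ ⋃ t ∈ place Q '' X, t.region := hcov ▸ Set.mem_univ z
    simp only [Set.mem_iUnion, Set.mem_image] at hz'
    obtain ⟨_, ⟨t', ht', rfl⟩, hzt⟩ := hz'
    by_cases h : t' = t
    · exact h ▸ hzt
    · refine (hzC ?_).elim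
      simp only [Set.mem_iUnion]
      exact ⟨t', ⟨⟨ht', z, hzt, Metric.ball_subset_closedBall hz⟩, h⟩, hzt⟩
  · simp only [Set.mem_compl_iff, Set.mem_iUnion, not_exists]
    exact fun t' ht' => hcon t' ht'.1.1 ht'.2

theorem openSegment_subset_relint (u v : Pt) :
    openSegment ℝ (emb u) (emb v) ⊆ relint [u, v] := by
  rintro _ ⟨a, b, ha, hb, hab, rfl⟩ k
  have h : form k (a • emb u + b • emb v) = a * form k (emb u) + b * form k (emb v) := by
    rw [form_add, Complex.real_smul, Complex.real_smul, form_real_mul, form_real_mul]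
  have ha' : a = 1 - b := by linarith
  subst ha'
  simp only [h, List.mem_cons, List.not_mem_nil, or_false, exists_eq_or_imp, exists_eq_left,
    forall_eq_or_imp, forall_eq]
  rcases lt_trichotomy (form k (emb u)) (form k (emb v)) with h | h | h
  · left; right; nlinarith
  · right; rw [h]; constructor <;> ring
  · left; left; nlinarith

/-! ### Triangles paired along hypotenuses -/

/-- The other triangle on the hypotenuse of a triangle. -/
def partner : LTile → LTile
  | (x, .rhomb k) => (x, .rhomb k)
  | (x, .tri h e) =>
      (x + (ldir h + ldir (h + 2 * sgn e)), .tri (h + 2 * sgn e + 4) (!e))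

theorem ldir_add_four (k : ZMod 8) : ldir (k + 4) = -ldir k := by revert k; decide

def hypCell (x : Pt) (h : ZMod 8) (e : Bool) : Cell :=
  (x + ldir (h + 2 * sgn e), .hyp (h - sgn e))

theorem hypCell_mem_faces (x : Pt) (h : ZMod 8) (e : Bool) :
    hypCell x h e ∈ Cell.faces (LTile.cell (x, .tri h e)) := by
  simp [Cell.faces, LTile.cell, Shape.faces, Shape.boundary, TileShape.edges, shift, hypCell]

theorem exists_of_hyp_mem_faces {t : LTile} {c : Cell} {k : ZMod 8} (h : c ∈ t.cell.faces)
    (hc : c.2 = .hyp k) : ∃ h e, t.2 = .tri h e ∧ c = hypCell t.1 h e := by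
  obtain ⟨d, hd, rfl⟩ := List.mem_map.1 h
  obtain ⟨x, k | ⟨a, e⟩⟩ := t
  · simp only [LTile.cell, Shape.faces, Shape.boundary, Shape.verts, TileShape.edges, List.map_cons,
      List.map_nil, List.cons_append, List.nil_append, List.mem_cons, List.not_mem_nil,
      or_false] at hd
    rcases hd with rfl | rfl | rfl | rfl | rfl | rfl | rfl | rfl | rfl <;> simp [shift] at hc
  · refine ⟨a, e, rfl, ?_⟩
    simp only [LTile.cell, Shape.faces, Shape.boundary, Shape.verts, TileShape.edges, List.map_cons,
      List.map_nil, List.cons_append, List.nil_append, List.mem_cons, List.not_mem_nil,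
      or_false] at hd
    rcases hd with rfl | rfl | rfl | rfl | rfl | rfl | rfl <;>
      first | (simp [shift] at hc; done) | rfl

/-- A directed hypotenuse bounds just two triangles, one on each side, and the chirality tells the
side. -/
theorem eq_or_eq_partner {x x' : Pt} {h h' : ZMod 8} {e e' : Bool}
    (hc : hypCell x h e = hypCell x' h' e') :
    ((x', TileShape.tri h' e') : LTile) = (x, .tri h e) ∨
      ((x', TileShape.tri h' e') : LTile) = partner (x, .tri h e) := by
  simp only [hypCell, Prod.mk.injEq, Shape.hyp.injEq] at hc
  obtain ⟨h1, h2⟩ := hc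
  by_cases he : e = e'
  · subst he
    obtain rfl : h = h' := by simpa using h2
    left
    rw [add_right_cancel h1]
  · obtain rfl : e' = !e := by cases e <;> cases e' <;> simp_all
    right
    have e1 : sgn (!e) = -sgn e := by cases e <;> rfl
    have e4 : 4 * sgn e = 4 := by cases e <;> rfl
    have h8 : (4 : ZMod 8) + 4 = 0 := rfl
    obtain rfl : h' = h + 2 * sgn e + 4 := by
      rw [e1] at h2
      linear_combination -h2 - e4 - h8
    rw [partner]
    congr 1
    rw [e1, show h + 2 * sgn e + 4 + 2 * -sgn e = h + 4 by ring, ldir_add_four] at h1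
    rw [add_comm (ldir h), ← add_assoc, h1]
    abel

theorem partner_ne (x : Pt) (h : ZMod 8) (e : Bool) : partner (x, .tri h e) ≠ (x, .tri h e) := by
  simp [partner]

/-- The midpoint of the hypotenuse. -/
theorem midpoint_mem_hypCell (x : Pt) (h : ZMod 8) (e : Bool) :
    (emb (x + ldir h) + emb (x + ldir (h + 2 * sgn e))) / 2 ∈ (hypCell x h e).pts := by
  have h1 : mulSqrt (ldir (h - sgn e)) = ldir h - ldir (h + 2 * sgn e) := by
    revert h e; decide
  have h2 : (hypCell x h e).verts = [x + ldir (h + 2 * sgn e), x + ldir h] := by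
    simp [hypCell, Cell.verts, Shape.verts, h1]
  rw [Cell.pts, h2]
  refine openSegment_subset_relint _ _ ⟨1 / 2, 1 / 2, by norm_num, by norm_num, by norm_num, ?_⟩
  simp only [Complex.real_smul]
  push_cast
  ring

theorem sharesHypotenuse_place {X : Set LTile} (hX : IsComplex X) {Q : ℂ} {t t' : LTile}
    (ht : t ∈ X) (ht' : t' ∈ X) :
    (place Q t).SharesHypotenuse (place Q t') ↔
      (place Q t).IsTri ∧ t' = partner t := by
  obtain ⟨x, k | ⟨h, e⟩⟩ := t
  · simp [place, Tile.SharesHypotenuse, Tile.IsTri]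
  simp only [place_tri, Tile.IsTri, true_and]
  obtain ⟨x', k | ⟨h', e'⟩⟩ := t'
  · simp [place, Tile.SharesHypotenuse, partner]
  simp only [place_tri, Tile.SharesHypotenuse]
  constructor
  · rintro ⟨hne, hs⟩
    have hm : emb (x + ldir h) + emb (x + ldir (h + 2 * sgn e)) =
        emb (x' + ldir h') + emb (x' + ldir (h' + 2 * sgn e')) := by
      simp only [map_add, emb_ldir]
      rcases Sym2.eq_iff.1 hs with ⟨h1, h2⟩ | ⟨h1, h2⟩ <;> linear_combination h1 + h2
    have h1 := midpoint_mem_hypCell x h e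
    have h2 := midpoint_mem_hypCell x' h' e'
    rw [← hm] at h2
    have := hX _ ⟨_, ht, hypCell_mem_faces x h e⟩ _ ⟨_, ht', hypCell_mem_faces x' h' e'⟩ _ h1 h2
    refine (eq_or_eq_partner this).resolve_left fun h => hne ?_
    rw [← place_tri, ← place_tri, h]
  · intro h1
    have hne := partner_ne x h e
    rw [← h1] at hne
    refine ⟨fun h => hne (place_injective Q h.symm), ?_⟩
    have e1 : sgn (!e) = -sgn e := by cases e <;> rfl
    simp only [partner, Prod.mk.injEq, TileShape.tri.injEq] at h1
    obtain ⟨rfl, rfl, rfl⟩ := h1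
    rw [e1, show h + 2 * sgn e + 4 + 2 * -sgn e = h + 4 by ring, dir_add_four, dir_add_four]
    rw [Sym2.eq_iff]
    left
    simp only [map_add, emb_ldir]
    constructor <;> ring

/-- The midpoint of the hypotenuse lies in a second tile. The face of that tile through the midpoint
is the same directed hypotenuse, so the tile is the other triangle on it. -/
theorem partner_mem {X : Set LTile} (hX : IsComplex X) {Q : ℂ}
    (hcov : (⋃ t ∈ place Q '' X, t.region) = Set.univ) {x : Pt} {h : ZMod 8} {e : Bool}
    (ht : ((x, TileShape.tri h e) : LTile) ∈ X) : partner (x, .tri h e) ∈ X := by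
  set m := (emb (x + ldir h) + emb (x + ldir (h + 2 * sgn e))) / 2
  have hm : m ∈ (hypCell x h e).pts := midpoint_mem_hypCell x h e
  obtain ⟨t', ht', hne, hmt⟩ := hX.exists_ne_mem_region (Q := Q) hcov (t := (x, .tri h e))
    (m := m + Q) (by
      rw [interior_region_place, Set.mem_preimage, add_sub_cancel_right]
      intro hmc
      have := hX _ (cell_mem_cells ht) _ ⟨_, ht, hypCell_mem_faces x h e⟩ _ hmc hm
      simp [LTile.cell, hypCell] at this)
  obtain ⟨f, hf, hmf⟩ := mem_region_place.1 hmt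
  rw [add_sub_cancel_right] at hmf
  have := hX _ ⟨_, ht, hypCell_mem_faces x h e⟩ f ⟨t', ht', hf⟩ _ hm hmf
  subst this
  obtain ⟨h', e', h2, h3⟩ := exists_of_hyp_mem_faces hf rfl
  have ht2 : t' = (t'.1, .tri h' e') := by rw [← h2]
  rw [ht2] at ht' hne
  rwa [← (eq_or_eq_partner h3).resolve_left hne]

/-! ### Blocks and the finite checks for their borders -/

/-- The tiles of the block of a tile: a rhombus alone, or a triangle with its partner. -/
def TileShape.blockTiles : TileShape → List LTile
  | .rhomb k => [(0, .rhomb k)]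
  | .tri h e => [(0, .tri h e), partner (0, .tri h e)]

/-- The two directions that span the block of a tile. -/
def TileShape.span : TileShape → ZMod 8 × ZMod 8
  | .rhomb k => (k.val, k.val + 1)
  | .tri h e => (h, h + 2 * sgn e)

/-- The corners of the block of a tile. -/
def TileShape.blockVerts (s : TileShape) : List Pt :=
  [0, ldir s.span.1, ldir s.span.1 + ldir s.span.2, ldir s.span.2]

/-- Hypotenuses are left out because each is a diagonal of a square block and runs through its
interior. -/
def Shape.onBorder : Shape → Bool
  | .vert => true
  | .unit _ => true
  | _ => false

def TileShape.blockFaces (s : TileShape) : List Cell := s.blockTiles.flatMap fun t => t.cell.faces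

/-- The cells of the subdivision of a doubly inflated cell. -/
def Cell.subTwo (c : Cell) : List Cell := c.sub.flatMap Cell.sub

/-- The vertices of the border of the second-level supertile of a block, in cyclic order. -/
def TileShape.cyc (s : TileShape) (i : Fin 20) : Pt :=
  let u := ldir s.span.1
  let v := ldir s.span.2
  -- The quotient by 5 names the side (its corner and direction of travel), the remainder the place
  -- 0, 1, λ, 1 + λ or 2λ along it. The edge lengths 1, √2, 1, √2, 1 form a palindrome, so
  -- travelling against the direction of a unit edge meets the same points.
  let start : Pt × Pt := match i.val / 5 with
    | 0 => (0, u)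
    | 1 => (u, v)
    | 2 => (u + v, -u)
    | _ => (v, -v)
  mulLam (mulLam start.1) + match i.val % 5 with
    | 0 => 0
    | 1 => start.2
    | 2 => mulLam start.2
    | 3 => start.2 + mulLam start.2
    | _ => mulLam start.2 + mulLam start.2

def fins : List (Fin 20) := List.finRange 20

theorem block_fat : (tileShapes.all fun s => fat s.blockVerts) = true := by decide +kernel

/-- Vertices and unit edges are shown to lie on a supporting line of the block and all other faces
in its interior, so the frontier is the union of the former. -/
theorem block_faces : (tileShapes.all fun s => s.blockFaces.all fun f =>
    if f.2.onBorder then dirs.any fun k => s.blockVerts.all fun v => f.verts.all fun u => lle k v u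
    else inside f.verts s.blockVerts) = true := by
  have h : (tileShapes.all fun s => forceList forcePt s.blockVerts fun V => s.blockFaces.all fun f =>
      forceList forcePt f.verts fun U =>
      if f.2.onBorder then dirs.any fun k => V.all fun v => U.all fun u => lle k v u
      else inside U V) = true := by decide +kernel
  simpa only [forceList_eq forcePt_eq] using h

theorem block_verts : (tileShapes.all fun s => s.blockTiles.all fun t => t.cell.verts.all fun v =>
    s.blockVerts.contains v) = true := by decide +kernel

theorem cyc_pairwise : (tileShapes.all fun s => decide (fins.map s.cyc).Nodup) = true := by
  have h : (tileShapes.all fun s => forceList forcePt (fins.map s.cyc) fun L => decide L.Nodup) =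
      true := by decide +kernel
  simpa only [forceList_eq forcePt_eq] using h

/-- The cells of the border of the second-level supertile of a block. -/
def TileShape.borderCells (s : TileShape) : List Cell :=
  (s.blockFaces.filter fun f => f.2.onBorder).flatMap Cell.subTwo

/-- The edges of the cycle `cyc`. -/
def TileShape.cycEdges (s : TileShape) : List (List Pt) := fins.map fun i => [s.cyc i, s.cyc (i + 1)]

theorem subTwo_vert_mem_cyc : (tileShapes.all fun s => s.blockFaces.all fun f =>
    !f.2.onBorder || f.subTwo.all fun g => g.2 != .vert || (fins.map s.cyc).contains g.1) = true := by
  have h : (tileShapes.all fun s => forceList forcePt (fins.map s.cyc) fun L =>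
      forceList forceCell s.borderCells fun A => A.all fun g => g.2 != .vert || L.contains g.1) =
      true := by decide +kernel
  simpa only [forceList_eq forcePt_eq, forceList_eq forceCell_eq, TileShape.borderCells,
    List.all_flatMap, List.all_filter] using h

theorem cyc_mem_subTwo : (tileShapes.all fun s => fins.all fun i => s.blockFaces.any fun f =>
    f.2.onBorder && f.subTwo.contains (s.cyc i, .vert)) = true := by
  have h : (tileShapes.all fun s => forceList forcePt (fins.map s.cyc) fun L =>
      forceList forceCell s.borderCells fun A => L.all fun y => A.contains (y, .vert)) = true := by
    decide +kernel
  simpa only [forceList_eq forcePt_eq, forceList_eq forceCell_eq, TileShape.borderCells,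
    ← any_contains, List.any_filter, List.all_map, Function.comp_def] using h

theorem subTwo_edge_mem_cyc : (tileShapes.all fun s => s.blockFaces.all fun f =>
    !f.2.onBorder || f.subTwo.all fun g => g.2 == .vert || fins.any fun i =>
      g.verts == [s.cyc i, s.cyc (i + 1)] || g.verts == [s.cyc (i + 1), s.cyc i]) = true := by
  have h : (tileShapes.all fun s => forceList (forceList forcePt) s.cycEdges fun L =>
      s.borderCells.all fun g => forceList forcePt g.verts fun V =>
      g.2 == .vert || L.any fun e => V == e || V == e.reverse) = true := by decide +kernel
  have hr : ∀ a b : Pt, [a, b].reverse = [b, a] := fun _ _ => rfl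
  simpa only [hr, forceList_eq (forceList_eq forcePt_eq), forceList_eq forcePt_eq,
    TileShape.borderCells, TileShape.cycEdges, List.any_map, List.all_flatMap, List.all_filter,
    Function.comp_def] using h

theorem cyc_edge_mem_subTwo : (tileShapes.all fun s => fins.all fun i => s.blockFaces.any fun f =>
    f.2.onBorder && f.subTwo.any fun g =>
      g.verts == [s.cyc i, s.cyc (i + 1)] || g.verts == [s.cyc (i + 1), s.cyc i]) = true := by
  have h : (tileShapes.all fun s => forceList (forceList forcePt) s.cycEdges fun L =>
      forceList (forceList forcePt) (s.borderCells.map Cell.verts) fun A =>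
      L.all fun e => A.any fun V => V == e || V == e.reverse) = true := by decide +kernel
  have hr : ∀ a b : Pt, [a, b].reverse = [b, a] := fun _ _ => rfl
  simpa only [hr, forceList_eq (forceList_eq forcePt_eq), TileShape.borderCells, TileShape.cycEdges,
    List.any_map, List.any_flatMap, List.any_filter, List.all_map, Function.comp_def] using h

/-! ### Vertices and edges of the graph as cells -/

theorem vert_mem_faces {t : LTile} {x : Pt} :
    ((x, Shape.vert) : Cell) ∈ t.cell.faces ↔ x ∈ t.cell.verts := by
  obtain ⟨y, k | ⟨h, e⟩⟩ := t <;>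
    simp [Cell.faces, LTile.cell, Shape.faces, Shape.boundary, TileShape.edges, shift, Cell.verts,
      Shape.verts]

theorem mem_vertexSet_place {Q z : ℂ} {Y : Set LTile} :
    z ∈ vertexSet (place Q '' Y) ↔ ∃ x, ((x, Shape.vert) : Cell) ∈ cells Y ∧ Q + emb x = z := by
  constructor
  · rintro ⟨_, ⟨t, ht, rfl⟩, hz⟩
    rw [corners_place] at hz
    obtain ⟨x, hx, rfl⟩ := hz
    exact ⟨x, ⟨t, ht, vert_mem_faces.2 hx⟩, rfl⟩
  · rintro ⟨x, ⟨t, ht, hx⟩, rfl⟩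
    refine ⟨_, ⟨t, ht, rfl⟩, ?_⟩
    rw [corners_place]
    exact ⟨x, vert_mem_faces.1 hx, rfl⟩

/-- The cell is an edge from `a` to `b`. -/
def Cell.Joins (g : Cell) (a b : Pt) : Prop := g.verts = [a, b]

theorem sides_place {Q : ℂ} {t : LTile} {m : Sym2 ℂ} :
    m ∈ (place Q t).sides ↔
      ∃ g ∈ t.cell.faces, ∃ a b, g.Joins a b ∧ m = s(Q + emb a, Q + emb b) := by
  have h5 : ∀ k : ZMod 8, ldir (k + 5) = -ldir (k + 1) := by decide
  have hs : ∀ (h : ZMod 8) (e : Bool), mulSqrt (ldir (h - sgn e)) =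
      ldir h - ldir (h + 2 * sgn e) := by decide
  obtain ⟨x, k | ⟨h, e⟩⟩ := t
  · simp only [place_rhomb, Tile.sides, Set.mem_insert_iff, Set.mem_singleton_iff, Cell.faces,
      LTile.cell, Shape.faces, Shape.boundary, TileShape.edges, Shape.verts, shift, Cell.Joins,
      Cell.verts, List.map_cons, List.map_nil, List.cons_append, List.nil_append, List.mem_cons,
      List.not_mem_nil, or_false, exists_eq_or_imp, exists_eq_left, List.cons.injEq, and_true,
      reduceCtorEq, and_false, false_and, exists_false, false_or, and_assoc, exists_and_left,
      exists_eq_left', ldir_add_four, h5]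
    simp only [map_add, emb_ldir, add_zero, add_assoc, add_neg_cancel, add_neg_cancel_comm_assoc]
    rw [Sym2.eq_swap (a := Q + (emb x + dir (k.val + 1))) (b := Q + emb x),
      Sym2.eq_swap (a := Q + (emb x + (dir k.val + dir (k.val + 1)))) (b := Q + (emb x + dir k.val))]
    tauto
  · simp only [place_tri, Tile.sides, Set.mem_insert_iff, Set.mem_singleton_iff, Cell.faces,
      LTile.cell, Shape.faces, Shape.boundary, TileShape.edges, Shape.verts, shift, Cell.Joins,
      Cell.verts, List.map_cons, List.map_nil, List.cons_append, List.nil_append, List.mem_cons,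
      List.not_mem_nil, or_false, exists_eq_or_imp, exists_eq_left, List.cons.injEq, and_true,
      reduceCtorEq, and_false, false_and, exists_false, false_or, and_assoc, exists_and_left,
      exists_eq_left', ldir_add_four, hs]
    simp only [map_add, emb_ldir, add_zero, add_assoc, add_neg_cancel, add_sub_cancel]
    rw [Sym2.eq_swap (a := Q + (emb x + dir (h + 2 * sgn e))) (b := Q + (emb x + dir h)),
      Sym2.eq_swap (a := Q + (emb x + dir (h + 2 * sgn e))) (b := Q + emb x),
      Sym2.eq_swap (a := Q + (emb x + dir h)) (b := Q + emb x)]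
    tauto

theorem graph_adj_place {Q : ℂ} {Y : Set LTile} {v w : vertexSet (place Q '' Y)} :
    (graph (place Q '' Y)).Adj v w ↔ v ≠ w ∧ ∃ g ∈ cells Y, ∃ a b, g.Joins a b ∧
      s((v : ℂ), (w : ℂ)) = s(Q + emb a, Q + emb b) := by
  refine and_congr_right fun _ => ?_
  constructor
  · rintro ⟨_, ⟨t, ht, rfl⟩, h⟩
    obtain ⟨g, hg, h⟩ := sides_place.1 h
    exact ⟨g, ⟨t, ht, hg⟩, h⟩
  · rintro ⟨g, ⟨t, ht, hg⟩, h⟩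
    exact ⟨_, ⟨t, ht, rfl⟩, sides_place.2 ⟨g, hg, h⟩⟩

theorem Cell.mem_subTwo {c g : Cell} : g ∈ c.subTwo ↔ ∃ d ∈ c.sub, g ∈ d.sub := List.mem_flatMap

theorem mem_cells_lsubst_lsubst {X : Set LTile} {g : Cell} :
    g ∈ cells (lsubst (lsubst X)) ↔ ∃ f ∈ cells X, g ∈ f.subTwo := by
  simp only [mem_cells_lsubst, Cell.mem_subTwo]
  tauto

theorem mem_pts_of_mem_subTwo {c g : Cell} (hg : g ∈ c.subTwo) {w : ℂ}
    (hw : (lam : ℂ) * (lam * w) ∈ g.pts) : w ∈ c.pts := by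
  obtain ⟨d, hd, hg⟩ := Cell.mem_subTwo.1 hg
  exact mem_pts_of_mem_sub hd (mem_pts_of_mem_sub hg hw)

theorem subTwo_shift (x : Pt) (c : Cell) :
    Cell.subTwo (shift x c) = c.subTwo.map (shift (mulLam (mulLam x))) := by
  simp only [Cell.subTwo, sub_shift, List.flatMap_map, List.map_flatMap]

theorem exists_coords_block {s : TileShape} {w : ℂ} (hw : w ∈ hull s.blockVerts) :
    ∃ a b : ℝ, a ∈ Set.Icc 0 1 ∧ b ∈ Set.Icc 0 1 ∧ w = a * dir s.span.1 + b * dir s.span.2 := by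
  rcases s with k | ⟨h, _ | _⟩
  · exact exists_coords (by simp [TileShape.span, form_dir_add_one]) hw
  · have e1 : h + 2 * sgn false = h - 2 := by simp [sgn]; ring
    obtain ⟨a, b, ha, hb, h1⟩ := exists_coords (i := h - 2) (j := h - 2 + 2)
      (by rw [form_dir_add_two]; positivity) (w := w) (by
        refine (hull_congr fun v => ?_).subset hw
        simp only [TileShape.blockVerts, TileShape.span, e1, sub_add_cancel, List.mem_cons,
          List.not_mem_nil, or_false, add_comm (ldir h)]
        tauto)
    refine ⟨b, a, hb, ha, ?_⟩
    rw [h1, add_comm]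
    simp [TileShape.span, e1]
  · exact exists_coords (by simp [TileShape.span, sgn, form_dir_add_two]) hw

/-! ### Regions, frontiers and borders of blocks -/

/-- The region of the block of a tile. -/
def blockRegion (Q : ℂ) (t : LTile) : Set ℂ :=
  ⋃ t' ∈ {t' | t' ∈ t.2.blockTiles}, (place Q (shift t.1 t')).region

theorem blockRegion_rhomb (Q : ℂ) (x : Pt) (k : Fin 4) :
    blockRegion Q (x, .rhomb k) = (place Q (x, .rhomb k)).region := by
  simp [blockRegion, TileShape.blockTiles, shift]

theorem shift_partner (x : Pt) (h : ZMod 8) (e : Bool) :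
    shift x (partner (0, .tri h e)) = partner (x, .tri h e) := by
  simp [shift, partner]

theorem blockRegion_tri (Q : ℂ) (x : Pt) (h : ZMod 8) (e : Bool) :
    blockRegion Q (x, .tri h e) =
      (place Q (x, .tri h e)).region ∪ (place Q (partner (x, .tri h e))).region := by
  simp [blockRegion, TileShape.blockTiles, ← shift_partner x h e, Set.iUnion_or,
    Set.iUnion_union_distrib]
  simp [shift]

theorem verts_shift (x : Pt) (c : Cell) : Cell.verts (shift x c) = c.verts.map (x + ·) := by
  simp only [Cell.verts, List.map_map]
  apply List.map_congr_left
  intro v _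
  exact add_assoc x c.1 v

theorem blockRegion_eq_hull (Q : ℂ) (t : LTile) :
    blockRegion Q t = (· - Q) ⁻¹' hull (t.2.blockVerts.map (t.1 + ·)) := by
  apply Set.Subset.antisymm
  · refine Set.iUnion₂_subset fun t' ht' z hz => ?_
    rw [region_place] at hz
    have hz : z - Q ∈ hull ((t'.cell.verts).map (t.1 + ·)) := by
      rwa [← verts_shift]
    refine mem_hull_translate.2 fun k => ?_
    obtain ⟨v, hv, h⟩ := mem_hull_translate.1 hz k
    have := block_verts
    simp only [List.all_eq_true, List.contains_iff_mem] at this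
    exact ⟨v, this _ (mem_tileShapes _) t' ht' v hv, h⟩
  · intro z hz
    obtain ⟨x, k | ⟨h, e⟩⟩ := t
    · rw [blockRegion_rhomb, region_place]
      exact hz
    · rw [blockRegion_tri]
      obtain ⟨a, b, ha, hb, hab⟩ := exists_coords_block (mem_hull_translate.1 hz)
      simp only [TileShape.span] at hab
      -- The line a + b = 1 is the common hypotenuse and decides between the two triangles.
      by_cases hab' : a + b ≤ 1
      · left
        have := mem_convexHull_triangle (p := Q + emb x) (u := dir h) (v := dir (h + 2 * sgn e))
          ha.1 hb.1 hab'
        rw [← hab] at this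
        simpa [place, Tile.region, Tile.corners] using this
      · right
        have := mem_convexHull_triangle (p := Q + emb x + dir h + dir (h + 2 * sgn e))
          (u := -dir (h + 2 * sgn e)) (v := -dir h) (a := 1 - b) (b := 1 - a)
          (by linarith [hb.2]) (by linarith [ha.2]) (by linarith)
        have e1 : sgn (!e) = -sgn e := by cases e <;> rfl
        have h2 : Q + emb x + dir h + dir (h + 2 * sgn e) +
            (((1 - b : ℝ) : ℂ) * -dir (h + 2 * sgn e) + ((1 - a : ℝ) : ℂ) * -dir h) = z := by
          push_cast
          linear_combination -hab
        rw [h2] at this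
        simp only [partner, place_tri, Tile.region, Tile.corners, e1, map_add, emb_ldir,
          show h + 2 * sgn e + 4 + 2 * -sgn e = h + 4 by ring, dir_add_four]
        simpa only [add_assoc] using this

theorem blockRegion_eq_convexHull (Q : ℂ) (t : LTile) :
    blockRegion Q t = convexHull ℝ {Q + emb t.1, Q + emb t.1 + dir t.2.span.1,
      Q + emb t.1 + dir t.2.span.1 + dir t.2.span.2, Q + emb t.1 + dir t.2.span.2} := by
  rw [blockRegion_eq_hull]
  apply Set.Subset.antisymm
  · intro z hz
    obtain ⟨a, b, ha, hb, hab⟩ := exists_coords_block (mem_hull_translate.1 hz)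
    have := mem_convexHull_parallelogram (p := Q + emb t.1) (u := dir t.2.span.1)
      (v := dir t.2.span.2) ha hb
    rw [← hab] at this
    simpa using this
  · convert convexHull_subset_hull Q _ using 2
    ext z
    simp only [TileShape.blockVerts, List.map_cons,
      List.map_nil, List.mem_cons, List.not_mem_nil, or_false, Set.mem_image, Set.mem_ofPred_eq,
      Set.mem_insert_iff, Set.mem_singleton_iff, exists_eq_or_imp, exists_eq_left, map_add,
      add_zero, emb_ldir, add_assoc, eq_comm (a := z)]

theorem I_mul_dir (k : ZMod 8) : Complex.I * dir k = dir (k + 2) := by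
  have h1 : ∀ x : Pt, emb (-x.2.2.1, -x.2.2.2, x.1, x.2.1) = Complex.I * emb x := fun x => by
    apply Complex.ext <;> simp [emb_re, emb_im] <;> ring
  have h2 : ∀ k : ZMod 8, ldir (k + 2) =
      (-(ldir k).2.2.1, -(ldir k).2.2.2, (ldir k).1, (ldir k).2.1) := by decide
  rw [← emb_ldir, ← emb_ldir, h2, h1]

theorem norm_dir (k : ZMod 8) : ‖dir k‖ = 1 := Complex.norm_exp_ofReal_mul_I _

theorem isUnitSquare_blockRegion (Q : ℂ) (x : Pt) (h : ZMod 8) (e : Bool) :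
    IsUnitSquare (blockRegion Q (x, .tri h e)) := by
  rw [blockRegion_eq_convexHull]
  cases e
  · have e1 : h + 2 * sgn false = h - 2 := by simp [sgn]; ring
    refine ⟨Q + emb x, dir (h - 2), norm_dir _, ?_⟩
    simp only [TileShape.span, e1]
    rw [I_mul_dir, sub_add_cancel]
    congr 1
    ext z
    simp only [Set.mem_insert_iff, Set.mem_singleton_iff, add_assoc, add_comm (dir h)]
    tauto
  · refine ⟨Q + emb x, dir h, norm_dir _, ?_⟩
    rw [I_mul_dir]
    simp [TileShape.span, sgn]

theorem mem_frontier_blockRegion {Q z : ℂ} {t : LTile} :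
    z ∈ frontier (blockRegion Q t) ↔
      ∃ f ∈ t.2.blockFaces, f.2.onBorder = true ∧ z - Q ∈ Cell.pts (shift t.1 f) := by
  have hfat := block_fat
  simp only [List.all_eq_true] at hfat
  have hfaces := block_faces
  simp only [List.all_eq_true] at hfaces
  have hcl : IsClosed (blockRegion Q t) := by
    rw [blockRegion_eq_hull]
    exact (isClosed_hull _).preimage (continuous_sub_right Q)
  have hint : ∀ z, z ∈ interior (blockRegion Q t) ↔ z - Q - emb t.1 ∈ openHull t.2.blockVerts := by
    intro z
    rw [blockRegion_eq_hull, interior_preimage_sub, interior_hull, ← openHull_translate]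
    rfl
  have hbd : ∀ f ∈ t.2.blockFaces, z - Q ∈ Cell.pts (shift t.1 f) →
      (f.2.onBorder = true ↔ z ∉ interior (blockRegion Q t)) := by
    intro f hf hz
    have h1 := hfaces t.2 (mem_tileShapes _) f hf
    rw [mem_pts_shift] at hz
    rw [hint]
    split_ifs at h1 with hb
    · simp only [hb, true_iff]
      simp only [List.any_eq_true, List.all_eq_true] at h1
      obtain ⟨k, -, h1⟩ := h1
      intro hop
      obtain ⟨v, hv, h2⟩ := hop k
      have h3 := hz (k + 4)
      simp only [form_add_four, neg_lt_neg_iff, neg_inj] at h3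
      rcases h3 with ⟨u, hu, h3⟩ | h3
      · linarith [lle_sound (h1 v hv u hu)]
      · have hu := List.head_mem (Cell.verts_ne_nil f)
        linarith [lle_sound (h1 v hv _ hu), h3 _ hu]
    · simp only [hb, Bool.false_eq_true, false_iff, not_not]
      rw [← relint_of_fat (hfat _ (mem_tileShapes _))]
      exact relint_subset_of_inside (Cell.verts_ne_nil _) h1 hz
  have hmem : z ∈ blockRegion Q t ↔ ∃ f ∈ t.2.blockFaces, z - Q ∈ Cell.pts (shift t.1 f) := by
    simp only [blockRegion, Set.mem_iUnion, mem_region_place, cell_shift, faces_shift,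
      TileShape.blockFaces, List.mem_flatMap, List.mem_map, Set.mem_ofPred_eq]
    constructor
    · rintro ⟨t', ht', _, ⟨f, hf, rfl⟩, hz⟩
      exact ⟨f, ⟨t', ht', hf⟩, hz⟩
    · rintro ⟨f, ⟨t', ht', hf⟩, hz⟩
      exact ⟨t', ht', _, ⟨f, hf, rfl⟩, hz⟩
  rw [hcl.frontier_eq, Set.mem_sdiff, hmem]
  constructor
  · rintro ⟨⟨f, hf, hz⟩, hn⟩
    exact ⟨f, hf, (hbd f hf hz).2 hn, hz⟩
  · rintro ⟨f, hf, hb, hz⟩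
    exact ⟨⟨f, hf, hz⟩, (hbd f hf hz).1 hb⟩

theorem mem_frontier_supertile {K : Set ℂ} {z : ℂ} :
    (lam : ℂ) * (lam * z) ∈ frontier (supertile K) ↔ z ∈ frontier K := by
  have h0 : ((lam ^ 2 : ℝ) : ℂ) ≠ 0 := by exact_mod_cast (pow_pos lam_pos 2).ne'
  have h1 : supertile K = Homeomorph.mulLeft₀ _ h0 '' K := rfl
  rw [h1, ← Homeomorph.image_frontier]
  have h2 : (lam : ℂ) * (lam * z) = Homeomorph.mulLeft₀ _ h0 z := by
    simp only [Homeomorph.coe_mulLeft₀]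
    push_cast
    ring
  rw [h2, (Homeomorph.injective _).mem_set_image]

/-- Dividing by λ² gives a point in the cell f' of X that g comes from. If the point is also in a
border face, that face and f' overlap and hence agree. So a cell of the inflated complex lies wholly
on the frontier or misses it. -/
theorem mem_frontier_iff {X : Set LTile} (hX : IsComplex X) {Q O : ℂ}
    (hO : O = lam * (lam * Q)) {t : LTile}
    (ht : ∀ t' ∈ t.2.blockTiles, shift t.1 t' ∈ X) {g : Cell}
    (hg : g ∈ cells (lsubst (lsubst X))) {p : ℂ} (hp : p ∈ g.pts) :
    O + p ∈ frontier (supertile (blockRegion Q t)) ↔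
      ∃ f ∈ t.2.blockFaces, f.2.onBorder = true ∧ g ∈ Cell.subTwo (shift t.1 f) := by
  subst hO
  obtain ⟨q, rfl⟩ : ∃ q, (lam : ℂ) * (lam * q) = p := ⟨p / lam / lam, by simp only [lam_mul_div]⟩
  rw [← mul_add, ← mul_add, mem_frontier_supertile, mem_frontier_blockRegion, add_sub_cancel_left]
  refine exists_congr fun f => and_congr_right fun hf => and_congr_right fun _ => ?_
  refine ⟨fun hq => ?_, fun h => mem_pts_of_mem_subTwo h hp⟩
  obtain ⟨f', hf', hgf⟩ := mem_cells_lsubst_lsubst.1 hg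
  obtain ⟨t', ht', hft⟩ := List.mem_flatMap.1 hf
  have : shift t.1 f ∈ cells X :=
    ⟨_, ht t' ht', by rw [cell_shift, faces_shift]; exact List.mem_map_of_mem hft⟩
  rwa [hX _ this f' hf' q hq (mem_pts_of_mem_subTwo hgf hp)]

theorem Cell.joins_shift {g : Cell} {x a b : Pt} (h : g.Joins a b) :
    Cell.Joins (shift x g) (x + a) (x + b) := by
  rw [Cell.Joins, verts_shift, h]; rfl

theorem Cell.joins_of_shift {g : Cell} {x a b : Pt} (h : Cell.Joins (shift x g) a b) :
    ∃ a' b', g.Joins a' b' ∧ a = x + a' ∧ b = x + b' := by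
  rw [Cell.Joins, verts_shift] at h
  rcases hv : g.verts with _ | ⟨a', _ | ⟨b', _ | _⟩⟩ <;> rw [hv] at h <;>
    simp only [List.map_cons, List.map_nil, List.cons.injEq, reduceCtorEq, and_false, and_true] at h
  exact ⟨a', b', hv, h.1.symm, h.2.symm⟩

theorem Cell.Joins.isEdge {g : Cell} {a b : Pt} (h : g.Joins a b) :
    (∃ k, g.2 = .unit k) ∨ ∃ k, g.2 = .hyp k := by
  obtain ⟨x, _ | k | k | (k | ⟨k, e⟩)⟩ := g <;> simp [Cell.Joins, Cell.verts, Shape.verts] at h ⊢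

theorem Cell.Joins.ne {g : Cell} {a b : Pt} (h : g.Joins a b) : a ≠ b := by
  have h1 : ∀ k, ldir k ≠ 0 := by decide
  have h2 : ∀ k, mulSqrt (ldir k) ≠ 0 := by decide
  obtain ⟨x, _ | k | k | (k | ⟨k, e⟩)⟩ := g <;>
    simp only [Cell.Joins, Cell.verts, Shape.verts, List.map_cons, List.map_nil, List.cons.injEq,
      reduceCtorEq, and_false, and_true] at h
  · rw [← h.1, ← h.2]
    intro h3
    exact h1 k (add_left_cancel h3).symm
  · rw [← h.1, ← h.2]
    intro h3
    exact h2 k (add_left_cancel h3).symm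

theorem faces_faces_subset : (tileShapes.all fun s => (Shape.tile s).faces.all fun f =>
    f.faces.all fun g => (Shape.tile s).faces.contains g) = true := by decide +kernel

theorem mem_cells_of_mem_faces {X : Set LTile} {f g : Cell} (hf : f ∈ cells X)
    (hg : g ∈ f.faces) : g ∈ cells X := by
  obtain ⟨t, ht, hf⟩ := hf
  obtain ⟨f, hf', rfl⟩ := List.mem_map.1 hf
  rw [faces_shift] at hg
  obtain ⟨g, hg', rfl⟩ := List.mem_map.1 hg
  have := faces_faces_subset
  simp only [List.all_eq_true, List.contains_iff_mem] at this
  exact ⟨t, ht, List.mem_map_of_mem (this t.2 (mem_tileShapes _) f hf' g hg')⟩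

/-- A point of the lattice, seen from the origin `O`, as a vertex of a tiling. -/
noncomputable def vertexAt (O : ℂ) (Y : Set LTile) (x : Pt)
    (hx : ((x, Shape.vert) : Cell) ∈ cells Y) : vertexSet (place O '' Y) :=
  ⟨O + emb x, mem_vertexSet_place.2 ⟨x, hx, rfl⟩⟩

theorem Cell.Joins.pts {g : Cell} {a b : Pt} (h : g.Joins a b) :
    openSegment ℝ (emb a) (emb b) ⊆ g.pts := by
  rw [Cell.pts, h]
  exact openSegment_subset_relint a b

theorem openSegment_add (O u v : ℂ) :
    openSegment ℝ (O + u) (O + v) = (O + ·) '' openSegment ℝ u v :=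
  (openSegment_translate_image ℝ O u v).symm

theorem block_subset {X : Set LTile} {t : LTile} {f : Cell}
    (ht : ∀ t' ∈ t.2.blockTiles, shift t.1 t' ∈ X) (hf : f ∈ t.2.blockFaces) :
    shift t.1 f ∈ cells X := by
  obtain ⟨t', ht', hft⟩ := List.mem_flatMap.1 hf
  exact ⟨_, ht t' ht', by rw [cell_shift, faces_shift]; exact List.mem_map_of_mem hft⟩

theorem subTwo_mem_cells {X : Set LTile} {t : LTile} {f g : Cell}
    (ht : ∀ t' ∈ t.2.blockTiles, shift t.1 t' ∈ X) (hf : f ∈ t.2.blockFaces) (hg : g ∈ f.subTwo) :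
    shift (mulLam (mulLam t.1)) g ∈ cells (lsubst (lsubst X)) := by
  refine mem_cells_lsubst_lsubst.2 ⟨_, block_subset ht hf, ?_⟩
  rw [subTwo_shift]
  exact List.mem_map_of_mem hg

theorem cyc_injective (s : TileShape) : Function.Injective s.cyc := by
  have := cyc_pairwise
  simp only [List.all_eq_true, decide_eq_true_eq] at this
  exact fun i j h => List.inj_on_of_nodup_map (this s (mem_tileShapes s)) (List.mem_finRange i)
    (List.mem_finRange j) h

/-- The segment between adjacent vertices lies in a frontier if and only if the open edge does. -/
theorem segment_subset_frontier {K : Set ℂ} {O : ℂ} {a b : Pt}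
    (h : ∀ p ∈ openSegment ℝ (emb a) (emb b), O + p ∈ frontier K) :
    segment ℝ (O + emb a) (O + emb b) ⊆ frontier K := by
  rw [← closure_openSegment, openSegment_add]
  refine isClosed_frontier.closure_subset_iff.2 ?_
  rintro _ ⟨p, hp, rfl⟩
  exact h p hp

theorem midpoint_mem_openSegment (u v : ℂ) : (1 / 2 : ℝ) • u + (1 / 2 : ℝ) • v ∈ openSegment ℝ u v :=
  ⟨1 / 2, 1 / 2, by norm_num, by norm_num, by norm_num, rfl⟩

theorem border_adj_iff {X : Set LTile} (hX : IsComplex X) {Q O : ℂ}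
    (hO : O = lam * (lam * Q)) {t : LTile} (ht : ∀ t' ∈ t.2.blockTiles, shift t.1 t' ∈ X)
    {v w : vertexSet (place O '' lsubst (lsubst X))} :
    (border (place O '' lsubst (lsubst X)) (supertile (blockRegion Q t))).Adj v w ↔
      ∃ f ∈ t.2.blockFaces, f.2.onBorder = true ∧ ∃ g ∈ Cell.subTwo (shift t.1 f), ∃ a b,
        g.Joins a b ∧ s((v : ℂ), (w : ℂ)) = s(O + emb a, O + emb b) := by
  constructor
  · rintro ⟨hadj, hseg⟩
    obtain ⟨-, g, hg, a, b, hab, hs⟩ := graph_adj_place.1 hadj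
    -- The midpoint of an edge decides whether the open edge lies on the frontier; the ends alone
    -- would not.
    have hmid : O + ((1 / 2 : ℝ) • emb a + (1 / 2 : ℝ) • emb b) ∈
        frontier (supertile (blockRegion Q t)) := by
      have h1 : openSegment ℝ (v : ℂ) w = openSegment ℝ (O + emb a) (O + emb b) := by
        rcases Sym2.eq_iff.1 hs with ⟨h1, h2⟩ | ⟨h1, h2⟩
        · rw [h1, h2]
        · rw [h1, h2, openSegment_symm]
      refine hseg (openSegment_subset_segment _ _ _ ?_)
      rw [h1, openSegment_add]
      exact ⟨_, midpoint_mem_openSegment _ _, rfl⟩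
    obtain ⟨f, hf, hb, h⟩ := (mem_frontier_iff hX hO ht hg
      (hab.pts (midpoint_mem_openSegment _ _))).1 hmid
    exact ⟨f, hf, hb, g, h, a, b, hab, hs⟩
  · rintro ⟨f, hf, hb, g, hg, a, b, hab, hs⟩
    have hgY : g ∈ cells (lsubst (lsubst X)) :=
      mem_cells_lsubst_lsubst.2 ⟨_, block_subset ht hf, hg⟩
    have hseg : segment ℝ (O + emb a) (O + emb b) ⊆ frontier (supertile (blockRegion Q t)) :=
      segment_subset_frontier fun p hp =>
        (mem_frontier_iff hX hO ht hgY (hab.pts hp)).2 ⟨f, hf, hb, hg⟩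
    have hne : O + emb a ≠ O + emb b := fun h => hab.ne (emb_injective (add_left_cancel h))
    refine ⟨graph_adj_place.2 ⟨fun h => ?_, g, hgY, a, b, hab, hs⟩, ?_⟩
    · subst h
      rcases Sym2.eq_iff.1 hs with ⟨h1, h2⟩ | ⟨h1, h2⟩ <;> exact hne (by rw [← h1, ← h2])
    · rcases Sym2.eq_iff.1 hs with ⟨h1, h2⟩ | ⟨h1, h2⟩
      · rwa [h1, h2]
      · rwa [h1, h2, segment_symm]

/-- The border of the second-level supertile of a block is a cycle. -/
theorem isCycleOfLength_border {X : Set LTile} (hX : IsComplex X) {Q O : ℂ}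
    (hO : O = lam * (lam * Q)) {t : LTile} (ht : ∀ t' ∈ t.2.blockTiles, shift t.1 t' ∈ X) :
    IsCycleOfLength (border (place O '' lsubst (lsubst X)) (supertile (blockRegion Q t))) 20 := by
  set Y := lsubst (lsubst X)
  set x := mulLam (mulLam t.1)
  have hcyc : ∀ i, ∃ f ∈ t.2.blockFaces, f.2.onBorder = true ∧
      ((t.2.cyc i, Shape.vert) : Cell) ∈ f.subTwo := by
    have := cyc_mem_subTwo
    simp only [List.all_eq_true, List.any_eq_true, Bool.and_eq_true, List.contains_iff_mem] at this
    exact fun i => this _ (mem_tileShapes _) i (List.mem_finRange i)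
  have hcell : ∀ i, ((x + t.2.cyc i, Shape.vert) : Cell) ∈ cells Y := fun i => by
    obtain ⟨f, hf, -, h⟩ := hcyc i
    exact subTwo_mem_cells ht hf h
  let φ : Fin 20 → vertexSet (place O '' Y) := fun i => vertexAt O Y (x + t.2.cyc i) (hcell i)
  have hφ : Function.Injective φ := fun i j h => cyc_injective _ (add_left_cancel
    (emb_injective (add_left_cancel (congrArg Subtype.val h))))
  have hmem : ∀ i, φ i ∈ (border (place O '' Y) (supertile (blockRegion Q t))).verts := fun i => by
    obtain ⟨f, hf, hb, h⟩ := hcyc i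
    refine (mem_frontier_iff hX hO ht (hcell i) (mem_pts_vert.2 rfl)).2 ⟨f, hf, hb, ?_⟩
    rw [subTwo_shift]
    exact List.mem_map_of_mem (f := shift x) h
  have hsurj : ∀ v ∈ (border (place O '' Y) (supertile (blockRegion Q t))).verts, ∃ i, φ i = v := by
    rintro ⟨v, hv⟩ hvb
    obtain ⟨y, hy, rfl⟩ := mem_vertexSet_place.1 hv
    obtain ⟨f, hf, hb, h⟩ := (mem_frontier_iff hX hO ht hy (mem_pts_vert.2 rfl)).1 hvb
    rw [subTwo_shift] at h
    obtain ⟨g, hg, hgy⟩ := List.mem_map.1 h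
    simp only [shift, Prod.mk.injEq] at hgy
    have := subTwo_vert_mem_cyc
    simp only [List.all_eq_true, Bool.or_eq_true, Bool.not_eq_true', bne_iff_ne,
      List.contains_iff_mem, List.mem_map] at this
    obtain ⟨i, -, hi⟩ := (((this _ (mem_tileShapes _) f hf).resolve_left (by simp [hb])) g
      hg).resolve_left (by simp [hgy.2])
    refine ⟨i, Subtype.ext ?_⟩
    show O + emb (x + t.2.cyc i) = O + emb y
    rw [hi, ← hgy.1]
  have hadj : ∀ i j, (border (place O '' Y) (supertile (blockRegion Q t))).Adj (φ i) (φ j) ↔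
      i + 1 = j ∨ j + 1 = i := by
    intro i j
    constructor
    · intro hadj
      obtain ⟨f, hf, hb, g, h, a, b, hab, hs⟩ := (border_adj_iff hX hO ht).1 hadj
      rw [subTwo_shift] at h
      obtain ⟨d, hd, rfl⟩ := List.mem_map.1 h
      obtain ⟨a', b', hab', rfl, rfl⟩ := Cell.joins_of_shift hab
      have := subTwo_edge_mem_cyc
      simp only [List.all_eq_true, List.any_eq_true, Bool.or_eq_true, Bool.not_eq_true',
        beq_iff_eq] at this
      have hne : d.2 ≠ .vert := fun h => by
        rcases hab'.isEdge with ⟨k, hk⟩ | ⟨k, hk⟩ <;> simp [hk] at h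
      obtain ⟨l, -, hl⟩ := (((this _ (mem_tileShapes _) f hf).resolve_left (by simp [hb])) d
        hd).resolve_left hne
      rw [show Cell.verts d = [a', b'] from hab'] at hl
      simp only [List.cons.injEq, and_true] at hl
      have hi : ∀ i c, ((φ i : ℂ)) = O + emb (x + c) → t.2.cyc i = c := fun i c h =>
        add_left_cancel (emb_injective (add_left_cancel h))
      rcases Sym2.eq_iff.1 hs with ⟨h1, h2⟩ | ⟨h1, h2⟩
      · rcases hl with ⟨h3, h4⟩ | ⟨h3, h4⟩
        · left
          rw [cyc_injective _ ((hi i _ h1).trans h3), cyc_injective _ ((hi j _ h2).trans h4)]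
        · right
          rw [cyc_injective _ ((hi i _ h1).trans h3), cyc_injective _ ((hi j _ h2).trans h4)]
      · rcases hl with ⟨h3, h4⟩ | ⟨h3, h4⟩
        · right
          rw [cyc_injective _ ((hi j _ h2).trans h3), cyc_injective _ ((hi i _ h1).trans h4)]
        · left
          rw [cyc_injective _ ((hi j _ h2).trans h3), cyc_injective _ ((hi i _ h1).trans h4)]
    · have key : ∀ i, (border (place O '' Y) (supertile (blockRegion Q t))).Adj
          (φ i) (φ (i + 1)) := by
        intro i
        have := cyc_edge_mem_subTwo
        simp only [List.all_eq_true, List.any_eq_true, Bool.and_eq_true, Bool.or_eq_true,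
          beq_iff_eq] at this
        obtain ⟨f, hf, hb, g, hg, h⟩ := this _ (mem_tileShapes _) i (List.mem_finRange i)
        have main : ∀ i j, g.Joins (t.2.cyc i) (t.2.cyc j) →
            (border (place O '' Y) (supertile (blockRegion Q t))).Adj (φ i) (φ j) :=
          fun i j h => (border_adj_iff hX hO ht).2 ⟨f, hf, hb, _, by
            rw [subTwo_shift]; exact List.mem_map_of_mem hg, _, _, Cell.joins_shift h, rfl⟩
        rcases h with h | h
        · exact main _ _ h
        · exact (main _ _ h).symm
      rintro (rfl | rfl)
      · exact key i
      · exact (key j).symm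
  let ψ : Fin 20 ≃ (border (place O '' Y) (supertile (blockRegion Q t))).verts :=
    Equiv.ofBijective (fun i => ⟨φ i, hmem i⟩)
      ⟨fun i j h => hφ (congrArg Subtype.val h), fun v => by
        obtain ⟨i, hi⟩ := hsurj v v.2
        exact ⟨i, Subtype.ext hi⟩⟩
  refine ⟨RelIso.symm ⟨ψ, fun {i j} => ?_⟩⟩
  rw [SimpleGraph.Subgraph.coe_adj]
  show (border (place O '' Y) (supertile (blockRegion Q t))).Adj (φ i) (φ j) ↔ _
  rw [hadj, SimpleGraph.cycleGraph_adj, sub_eq_iff_eq_add', sub_eq_iff_eq_add', eq_comm (a := i),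
    eq_comm (a := j), or_comm]

/-! ### The standard colouring -/

/-- Parity of the coordinate sum. -/
def par (x : Pt) : Fin 2 := if (x.1 + x.2.1 + x.2.2.1 + x.2.2.2) % 2 = 0 then 0 else 1

/-- Exchange of the first two of three colours. -/
def flipColour (a : Fin 2) (c : Fin 3) : Fin 3 :=
  if a = 0 then c else if c = 0 then 1 else if c = 1 then 0 else 2

/-- The colours along the second-level inflation of a vertex or unit edge. -/
def borderTable : Shape → Pt → Fin 2
  | .unit k, y =>
      let d := ldir k
      if y = d ∨ y = mulLam d + d then 1 else 0
  | _, _ => 0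

/-- Rotation by `-45°`. -/
def rotInv (x : Pt) : Pt := (x.2.1, x.2.2.1, x.2.2.2, -x.1)

/-- Complex conjugation. -/
def conjPt (x : Pt) : Pt := (x.1, -x.2.2.2, -x.2.2.1, -x.2.1)

def lookup (ones twos : List Pt) (y : Pt) : Fin 3 :=
  if y ∈ twos then 2 else if y ∈ ones then 1 else 0

/-- A 3-colouring of the interior vertices of the second-level supertile of a rhombus. -/
def rhombTable : Pt → Fin 3 :=
  lookup [(1, 1, 1, -1), (2, 2, 1, -1), (3, 3, 1, -1), (4, 4, 1, -1)]
    [(1, 1, 0, 0), (1, 2, 1, -1), (2, 1, 1, -1), (3, 2, 1, -1), (2, 3, 1, -1), (4, 4, 2, -2),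
      (4, 3, 1, -1), (3, 4, 1, -1), (2, 2, 1, 0), (2, 2, 0, -1), (3, 3, 1, -2), (3, 3, 2, -1)]

/-- A 3-colouring of the interior vertices of the second-level supertile of a triangle. -/
def triTable : Pt → Fin 3 :=
  lookup [(1, 2, 1, 0), (0, 1, 0, 0), (1, 1, 1, 1)]
    [(0, 2, 2, 1), (1, 1, 2, 1), (1, 2, 1, 1), (2, 1, 1, 0), (1, 1, 0, 0), (1, 1, 1, -1),
      (0, 1, 1, 0), (2, 2, 0, -1)]

/-- The colours of the vertices in the second-level inflation of an open cell. -/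
def table : Shape → Pt → Fin 3
  -- The second-level inflation of a hypotenuse is a path of seven edges, but its ends are joined by
  -- two unit legs and so have equal colours. Alternation is impossible; the third colour is used
  -- once, at λd + d.
  | .hyp k, y =>
      let d := ldir k
      let l := mulLam d
      lookup [d, l + l, l + l + l] [l + d] y
  | .tile (.rhomb k), y => rhombTable (rotInv^[k.val] y)
  | .tile (.tri h true), y => triTable (rotInv^[h.val] y)
  | .tile (.tri h false), y => triTable (conjPt (rotInv^[h.val] y))
  | s, y => (borderTable s y).castSucc

/-- The vertex λ²x has the parity of x, and colours alternate along each inflated unit edge. The far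
end fits because five steps and a change of parity by one agree modulo 2. -/
def borderColour (f : Cell) (y : Pt) : Fin 2 :=
  par f.1 + borderTable f.2 (y - mulLam (mulLam f.1))

/-- The parity of the base point acts by exchanging colours 0 and 1, which on border cells is
addition modulo 2 (`colour_of_onBorder`) and leaves colour 2 alone. -/
def colour (f : Cell) (y : Pt) : Fin 3 :=
  flipColour (par f.1) (table f.2 (y - mulLam (mulLam f.1)))

/-- The vertices in the second-level inflation of a shape, with their colours. -/
def Shape.vertColours (s : Shape) : List (Pt × Fin 3) :=
  s.faces.flatMap fun f => (f.subTwo.filter fun g => g.2 == .vert).map fun g => (g.1, colour f g.1)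

theorem mem_vertColours {s : Shape} {y : Pt} {c : Fin 3} : (y, c) ∈ s.vertColours ↔
    ∃ f ∈ s.faces, ((y, Shape.vert) : Cell) ∈ f.subTwo ∧ colour f y = c := by
  simp only [Shape.vertColours, List.mem_flatMap, List.mem_map, List.mem_filter, beq_iff_eq,
    Prod.mk.injEq]
  constructor
  · rintro ⟨f, hf, ⟨_, _⟩, ⟨h, rfl⟩, rfl, rfl⟩
    exact ⟨f, hf, h, rfl⟩
  · rintro ⟨f, hf, h, rfl⟩
    exact ⟨f, hf, _, ⟨h, rfl⟩, rfl, rfl⟩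

noncomputable def forceColoured {β : Type} (p : Pt × Fin 3) (f : Pt × Fin 3 → β) : β :=
  forcePt p.1 fun x => match p.2 with
    | 0 => f (x, 0)
    | 1 => f (x, 1)
    | 2 => f (x, 2)

theorem forceColoured_eq {β : Type} (p : Pt × Fin 3) (f : Pt × Fin 3 → β) :
    forceColoured p f = f p := by
  obtain ⟨x, c⟩ := p
  rw [forceColoured, forcePt_eq]
  fin_cases c <;> rfl

/-- By `colour_shift` a translation affects colours only through an exchange of two of them, so
properness is tested on cells at the origin. The list `vertColours` runs over all faces, so edges
that join the interior to the border are included. -/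
theorem table_proper : (shapes.all fun s => (Cell.subTwo (0, s)).all fun g =>
    match g.verts with
    | [a, b] => s.vertColours.any fun p => p.1 == a && s.vertColours.any fun q =>
        q.1 == b && p.2 != q.2
    | _ => true) = true := by
  have h : (shapes.all fun s => forceList forceColoured s.vertColours fun L =>
      (Cell.subTwo (0, s)).all fun g => forceList forcePt g.verts fun V => match V with
        | [a, b] => L.any fun p => p.1 == a && L.any fun q => q.1 == b && p.2 != q.2
        | _ => true) = true := by decide +kernel
  simpa only [forceList_eq forceColoured_eq, forceList_eq forcePt_eq] using h

theorem colour_of_onBorder {f : Cell} (hf : f.2.onBorder = true) (y : Pt) :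
    colour f y = (borderColour f y).castSucc := by
  have h : ∀ a b : Fin 2, flipColour a b.castSucc = (a + b).castSucc := by decide
  obtain ⟨x, _ | k | k | s⟩ := f
  · exact h _ _
  · exact h _ _
  · simp [Shape.onBorder] at hf
  · simp [Shape.onBorder] at hf

theorem par_add (x y : Pt) : par (x + y) = par x + par y := by
  simp only [par, Prod.fst_add, Prod.snd_add]
  split_ifs <;> first | rfl | omega

theorem par_ldir (k : ZMod 8) : par (ldir k) = 1 := by revert k; decide

theorem colour_shift (x : Pt) (f : Cell) (y : Pt) :
    colour (shift x f) (mulLam (mulLam x) + y) = flipColour (par x) (colour f y) := by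
  have h : ∀ a b c, flipColour (a + b) c = flipColour a (flipColour b c) := by decide
  simp only [colour, shift, par_add, mulLam_add, add_sub_add_left_eq_sub, h]

theorem flipColour_injective (a : Fin 2) : Function.Injective (flipColour a) := by
  revert a; unfold Function.Injective; decide

/-- The ends of an edge in a second-level inflation belong to inflations of faces, and have
different colours. -/
theorem exists_colour_ne {f g : Cell} (hg : g ∈ f.subTwo) {a b : Pt} (hab : g.Joins a b) :
    ∃ f₁ ∈ f.faces, ∃ f₂ ∈ f.faces, ((a, Shape.vert) : Cell) ∈ f₁.subTwo ∧
      ((b, Shape.vert) : Cell) ∈ f₂.subTwo ∧ colour f₁ a ≠ colour f₂ b := by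
  have hf : f = shift f.1 (0, f.2) := by simp [shift]
  rw [hf, subTwo_shift] at hg
  obtain ⟨g, hg', rfl⟩ := List.mem_map.1 hg
  obtain ⟨a, b, hab', rfl, rfl⟩ := Cell.joins_of_shift hab
  have := table_proper
  simp only [List.all_eq_true] at this
  have := this f.2 (mem_shapes _) g hg'
  rw [show Cell.verts g = [a, b] from hab'] at this
  simp only [List.any_eq_true, Bool.and_eq_true, beq_iff_eq, bne_iff_ne] at this
  obtain ⟨⟨_, p⟩, hp, rfl, ⟨_, q⟩, hq, rfl, hne⟩ := this
  obtain ⟨f₁, hf₁, ha, rfl⟩ := mem_vertColours.1 hp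
  obtain ⟨f₂, hf₂, hb, rfl⟩ := mem_vertColours.1 hq
  refine ⟨shift f.1 f₁, List.mem_map_of_mem hf₁, shift f.1 f₂, List.mem_map_of_mem hf₂, ?_, ?_, ?_⟩
  · rw [subTwo_shift]
    exact List.mem_map_of_mem ha
  · rw [subTwo_shift]
    exact List.mem_map_of_mem hb
  · rw [colour_shift, colour_shift]
    exact fun h => hne (flipColour_injective _ h)

/-- This makes the colour of a vertex well defined: only one cell of X has it in its second-level
inflation. -/
theorem subTwo_vert_unique {X : Set LTile} (hX : IsComplex X) {f f' : Cell} (hf : f ∈ cells X)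
    (hf' : f' ∈ cells X) {y : Pt} (h : ((y, Shape.vert) : Cell) ∈ f.subTwo)
    (h' : ((y, Shape.vert) : Cell) ∈ f'.subTwo) : f = f' := by
  have hy : (lam : ℂ) * (lam * (emb y / lam / lam)) ∈ Cell.pts (y, .vert) := by
    rw [lam_mul_div, lam_mul_div]
    exact mem_pts_vert.2 rfl
  exact hX f hf f' hf' _ (mem_pts_of_mem_subTwo h hy) (mem_pts_of_mem_subTwo h' hy)

theorem onBorder_of_mem_faces {f g : Cell} (hf : f.2.onBorder = true) (hg : g ∈ f.faces) :
    g.2.onBorder = true := by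
  obtain ⟨x, _ | k | k | s⟩ := f
  · obtain ⟨d, hd, rfl⟩ := List.mem_map.1 hg
    simp only [Shape.faces, Shape.boundary, List.mem_cons, List.not_mem_nil, or_false] at hd
    subst hd; rfl
  · obtain ⟨d, hd, rfl⟩ := List.mem_map.1 hg
    simp only [Shape.faces, Shape.boundary, Shape.verts, List.map_cons, List.map_nil, List.mem_cons,
      List.not_mem_nil, or_false] at hd
    rcases hd with rfl | rfl | rfl <;> rfl
  · simp [Shape.onBorder] at hf
  · simp [Shape.onBorder] at hf

/-! ### The union of all borders and its 2-colouring -/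

theorem blockTiles_subset {X : Set LTile} (hX : IsComplex X) {Q : ℂ}
    (hcov : (⋃ t ∈ place Q '' X, t.region) = Set.univ)
    {t : LTile} (ht : t ∈ X) : ∀ t' ∈ t.2.blockTiles, shift t.1 t' ∈ X := by
  obtain ⟨x, k | ⟨h, e⟩⟩ := t
  · intro t' ht'
    rw [List.mem_singleton.1 ht']
    simpa [shift] using ht
  · intro t' ht'
    simp only [TileShape.blockTiles, List.mem_cons, List.not_mem_nil, or_false] at ht'
    rcases ht' with rfl | rfl
    · simpa [shift] using ht
    · rw [shift_partner]
      exact partner_mem hX hcov ht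

theorem mem_blocks {X : Set LTile} (hX : IsComplex X) {Q : ℂ}
    (hcov : (⋃ t ∈ place Q '' X, t.region) = Set.univ)
    {K : Set ℂ} : K ∈ blocks (place Q '' X) ↔ ∃ t ∈ X, K = blockRegion Q t := by
  constructor
  · rintro (⟨_, ⟨t, ht, rfl⟩, hr, rfl⟩ | ⟨_, ⟨t, ht, rfl⟩, _, ⟨t', ht', rfl⟩, hs, rfl⟩)
    · refine ⟨t, ht, ?_⟩
      obtain ⟨x, k | ⟨h, e⟩⟩ := t
      · rw [blockRegion_rhomb]
      · exact hr.elim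
    · refine ⟨t, ht, ?_⟩
      obtain ⟨htri, rfl⟩ := (sharesHypotenuse_place hX ht ht').1 hs
      obtain ⟨x, k | ⟨h, e⟩⟩ := t
      · exact htri.elim
      · rw [blockRegion_tri]
  · rintro ⟨⟨x, k | ⟨h, e⟩⟩, ht, rfl⟩
    · exact .inl ⟨_, ⟨_, ht, rfl⟩, trivial, blockRegion_rhomb Q x k⟩
    · have hp := partner_mem hX hcov ht
      exact .inr ⟨_, ⟨_, ht, rfl⟩, _, ⟨_, hp, rfl⟩,
        (sharesHypotenuse_place hX ht hp).2 ⟨trivial, rfl⟩, blockRegion_tri Q x h e⟩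

theorem exists_mem_blockFaces {X : Set LTile} {f : Cell} (hf : f ∈ cells X) :
    ∃ t ∈ X, ∃ f' ∈ t.2.blockFaces, f = shift t.1 f' := by
  obtain ⟨t, ht, hf⟩ := hf
  obtain ⟨d, hd, rfl⟩ := List.mem_map.1 hf
  refine ⟨t, ht, d, List.mem_flatMap.2 ⟨(0, t.2), ?_, ?_⟩, rfl⟩
  · rcases t.2 with k | ⟨h, e⟩ <;> simp [TileShape.blockTiles]
  · exact List.mem_map.2 ⟨d, hd, shift_zero d⟩

theorem mem_borders {X : Set LTile} (hX : IsComplex X) {Q : ℂ}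
    (hcov : (⋃ t ∈ place Q '' X, t.region) = Set.univ)
    {O : ℂ} (hO : O = lam * (lam * Q))
    {v : vertexSet (place O '' lsubst (lsubst X))} :
    v ∈ (borders (place O '' lsubst (lsubst X)) (place Q '' X)).verts ↔
      ∃ f ∈ cells X, f.2.onBorder = true ∧ ∃ y, ((y, Shape.vert) : Cell) ∈ f.subTwo ∧
        (v : ℂ) = O + emb y := by
  simp only [borders, SimpleGraph.Subgraph.verts_iSup, Set.mem_iUnion, mem_blocks hX hcov]
  obtain ⟨v, hv⟩ := v
  obtain ⟨y, hy, rfl⟩ := mem_vertexSet_place.1 hv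
  constructor
  · rintro ⟨_, ⟨t, ht, rfl⟩, h⟩
    have hb := blockTiles_subset hX hcov ht
    obtain ⟨f, hf, hfb, h⟩ := (mem_frontier_iff hX hO hb hy (mem_pts_vert.2 rfl)).1 h
    exact ⟨_, block_subset hb hf, hfb, y, h, rfl⟩
  · rintro ⟨f, hf, hfb, y', h, hyy⟩
    obtain rfl := emb_injective (add_left_cancel hyy)
    obtain ⟨t, ht, f', hf', rfl⟩ := exists_mem_blockFaces hf
    exact ⟨_, ⟨t, ht, rfl⟩, (mem_frontier_iff hX hO (blockTiles_subset hX hcov ht) hy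
      (mem_pts_vert.2 rfl)).2 ⟨f', hf', hfb, h⟩⟩

theorem borders_adj {X : Set LTile} (hX : IsComplex X) {Q : ℂ}
    (hcov : (⋃ t ∈ place Q '' X, t.region) = Set.univ)
    {O : ℂ} (hO : O = lam * (lam * Q))
    {v w : vertexSet (place O '' lsubst (lsubst X))} :
    (borders (place O '' lsubst (lsubst X)) (place Q '' X)).Adj v w ↔
      ∃ f ∈ cells X, f.2.onBorder = true ∧ ∃ g ∈ f.subTwo, ∃ a b, g.Joins a b ∧
        s((v : ℂ), (w : ℂ)) = s(O + emb a, O + emb b) := by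
  simp only [borders, SimpleGraph.Subgraph.iSup_adj, mem_blocks hX hcov]
  constructor
  · rintro ⟨_, ⟨t, ht, rfl⟩, h⟩
    have hb := blockTiles_subset hX hcov ht
    obtain ⟨f, hf, hfb, h⟩ := (border_adj_iff hX hO hb).1 h
    exact ⟨_, block_subset hb hf, hfb, h⟩
  · rintro ⟨f, hf, hfb, h⟩
    obtain ⟨t, ht, f', hf', rfl⟩ := exists_mem_blockFaces hf
    exact ⟨_, ⟨t, ht, rfl⟩,
      (border_adj_iff hX hO (blockTiles_subset hX hcov ht)).2 ⟨f', hf', hfb, h⟩⟩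

/-- The borders are 2-colourable. -/
theorem borders_colorable {X : Set LTile} (hX : IsComplex X) {Q : ℂ}
    (hcov : (⋃ t ∈ place Q '' X, t.region) = Set.univ)
    {O : ℂ} (hO : O = lam * (lam * Q)) :
    (borders (place O '' lsubst (lsubst X)) (place Q '' X)).coe.Colorable 2 := by
  have h : ∀ v : (borders (place O '' lsubst (lsubst X)) (place Q '' X)).verts, _ :=
    fun v => (mem_borders hX hcov hO).1 v.2
  choose F hF hFb y hy hv using h
  have key : ∀ v w : (borders (place O '' lsubst (lsubst X)) (place Q '' X)).verts,
      ∀ f ∈ cells X, f.2.onBorder = true → ∀ g ∈ f.subTwo, ∀ a b, g.Joins a b →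
      (v.1 : ℂ) = O + emb a → (w.1 : ℂ) = O + emb b →
        borderColour (F v) (y v) ≠ borderColour (F w) (y w) := by
    intro v w f hf hfb g hg a b hab hva hwb
    obtain ⟨f₁, hf₁, f₂, hf₂, ha, hb, hne⟩ := exists_colour_ne hg hab
    have ea : y v = a := emb_injective (add_left_cancel ((hv v).symm.trans hva))
    have eb : y w = b := emb_injective (add_left_cancel ((hv w).symm.trans hwb))
    have e1 : F v = f₁ := subTwo_vert_unique hX (hF v) (mem_cells_of_mem_faces hf hf₁) (hy v)
      (ea ▸ ha)
    have e2 : F w = f₂ := subTwo_vert_unique hX (hF w) (mem_cells_of_mem_faces hf hf₂) (hy w)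
      (eb ▸ hb)
    rw [colour_of_onBorder (onBorder_of_mem_faces hfb hf₁),
      colour_of_onBorder (onBorder_of_mem_faces hfb hf₂)] at hne
    rw [e1, e2, ea, eb]
    exact fun h => hne (congrArg _ h)
  refine ⟨SimpleGraph.Coloring.mk (fun v => borderColour (F v) (y v)) fun {v w} h => ?_⟩
  obtain ⟨f, hf, hfb, g, hg, a, b, hab, hs⟩ := (borders_adj hX hcov hO).1 h
  rcases Sym2.eq_iff.1 hs with ⟨h1, h2⟩ | ⟨h1, h2⟩
  · exact key v w f hf hfb g hg a b hab h1 h2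
  · exact (key w v f hf hfb g hg a b hab h2 h1).symm

/-! ### Extending a 2-colouring of the borders -/

/-- The vertices along the second-level inflation of a unit edge. -/
def unitPath (k : ZMod 8) : ℕ → Pt
  | 0 => 0
  | 1 => ldir k
  | 2 => mulLam (ldir k)
  | 3 => mulLam (ldir k) + ldir k
  | 4 => mulLam (ldir k) + mulLam (ldir k)
  | _ => mulLam (mulLam (ldir k))

theorem unitPath_edge : (dirs.all fun k => [0, 1, 2, 3, 4].all fun i =>
    (Cell.subTwo (0, .unit k)).any fun g => g.verts == [unitPath k i, unitPath k (i + 1)] ||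
      g.verts == [unitPath k (i + 1), unitPath k i]) = true := by decide +kernel

theorem unitPath_vert : (dirs.all fun k => (Cell.subTwo (0, .unit k)).all fun g => g.2 != .vert ||
    [1, 2, 3, 4].any fun i => g.1 == unitPath k i && borderTable (.unit k) g.1 == Fin.ofNat 2 i)
      = true := by decide +kernel

theorem fin_two_eq_add_one {a b : Fin 2} (h : a ≠ b) : b = a + 1 := by
  revert a b; decide

theorem zero_mem_verts (s : Shape) : (0 : Pt) ∈ s.verts := by
  rcases s with _ | _ | _ | (_ | _) <;> simp [Shape.verts]

/-- A 2-colouring of the borders differs from the standard one by a constant on each tile. -/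
theorem colouring_along_unit {cv : Pt → Fin 2} {x : Pt} {k : ZMod 8}
    (hcv : ∀ g ∈ Cell.subTwo (x, .unit k), ∀ a b, g.Joins a b → cv a ≠ cv b) :
    ∀ i ≤ 5, cv (mulLam (mulLam x) + unitPath k i) = cv (mulLam (mulLam x)) + Fin.ofNat 2 i := by
  have hx : ((x, Shape.unit k) : Cell) = shift x (0, .unit k) := by simp [shift]
  have hstep : ∀ i < 5, cv (mulLam (mulLam x) + unitPath k (i + 1)) =
      cv (mulLam (mulLam x) + unitPath k i) + 1 := by
    intro i hi
    have := unitPath_edge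
    simp only [List.all_eq_true, List.any_eq_true, Bool.or_eq_true, beq_iff_eq] at this
    obtain ⟨g, hg, h⟩ := this k (mem_dirs k) i (by interval_cases i <;> simp)
    have hg' : shift (mulLam (mulLam x)) g ∈ Cell.subTwo (x, .unit k) := by
      rw [hx, subTwo_shift]
      exact List.mem_map_of_mem hg
    refine fin_two_eq_add_one ?_
    rcases h with h | h
    · exact hcv _ hg' _ _ (Cell.joins_shift h)
    · exact (hcv _ hg' _ _ (Cell.joins_shift h)).symm
  intro i
  induction i with
  | zero => intro _; simp [unitPath]
  | succ i ih =>
    intro hi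
    rw [hstep i (by omega), ih (by omega), add_assoc]
    congr 1
    revert hi
    rcases i with _ | _ | _ | _ | _ | i
    iterate 5 intro _; rfl
    omega

theorem exists_extension {X : Set LTile} (hX : IsComplex X) {Q : ℂ}
    (hcov : (⋃ t ∈ place Q '' X, t.region) = Set.univ) {O : ℂ} (hO : O = lam * (lam * Q))
    (c : (borders (place O '' lsubst (lsubst X)) (place Q '' X)).coe.Coloring (Fin 2)) :
    ∃ C : (graph (place O '' lsubst (lsubst X))).Coloring (Fin 3),
      ∀ v : (borders (place O '' lsubst (lsubst X)) (place Q '' X)).verts,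
        C v = (c v).castSucc := by
  classical
  -- The colouring is transported to lattice points, with the irrelevant value 0 off the borders.
  obtain ⟨cv, hcv⟩ : ∃ cv : Pt → Fin 2,
      ∀ v : (borders (place O '' lsubst (lsubst X)) (place Q '' X)).verts, ∀ y,
        (v.1 : ℂ) = O + emb y →
        cv y = c v := by
    refine ⟨fun y => if h : ∃ v : (borders (place O '' lsubst (lsubst X)) (place Q '' X)).verts,
      (v.1 : ℂ) = O + emb y then c h.choose else 0, fun v y hv => ?_⟩
    have h : ∃ v : (borders (place O '' lsubst (lsubst X)) (place Q '' X)).verts,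
        (v.1 : ℂ) = O + emb y := ⟨v, hv⟩
    beta_reduce
    rw [dif_pos h]
    congr 1
    exact Subtype.ext (Subtype.ext (h.choose_spec.trans hv.symm))
  have hvert : ∀ f ∈ cells X, f.2.onBorder = true → ∀ y, ((y, Shape.vert) : Cell) ∈ f.subTwo →
      ∃ v : (borders (place O '' lsubst (lsubst X)) (place Q '' X)).verts, (v.1 : ℂ) = O + emb y :=
    fun f hf hfb y hy =>
      ⟨⟨⟨O + emb y, mem_vertexSet_place.2 ⟨y, mem_cells_lsubst_lsubst.2 ⟨f, hf, hy⟩, rfl⟩⟩,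
        (mem_borders hX hcov hO).2 ⟨f, hf, hfb, y, hy, rfl⟩⟩, rfl⟩
  have hne : ∀ f ∈ cells X, f.2.onBorder = true → ∀ g ∈ f.subTwo, ∀ a b, g.Joins a b →
      cv a ≠ cv b := by
    intro f hf hfb g hg a b hab
    obtain ⟨f₁, hf₁, f₂, hf₂, ha, hb, -⟩ := exists_colour_ne hg hab
    obtain ⟨v, hv⟩ := hvert f₁ (mem_cells_of_mem_faces hf hf₁) (onBorder_of_mem_faces hfb hf₁) a ha
    obtain ⟨w, hw⟩ := hvert f₂ (mem_cells_of_mem_faces hf hf₂) (onBorder_of_mem_faces hfb hf₂) b hb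
    rw [hcv v a hv, hcv w b hw]
    refine c.valid ?_
    exact (borders_adj hX hcov hO).2 ⟨f, hf, hfb, g, hg, a, b, hab, by rw [hv, hw]⟩
  -- The discrepancy, at the corner λ²x, between the given colouring and the standard one.
  let d : Pt → Fin 2 := fun x => cv (mulLam (mulLam x)) + par x
  -- Along a unit edge of X the given colouring changes five times and the parity once, so the
  -- discrepancy is unchanged.
  have hunit : ∀ x k, ((x, Shape.unit k) : Cell) ∈ cells X → d (x + ldir k) = d x := by
    intro x k hk
    have h5 := colouring_along_unit (hne _ hk rfl) 5 le_rfl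
    show cv (mulLam (mulLam (x + ldir k))) + par (x + ldir k) = cv (mulLam (mulLam x)) + par x
    rw [mulLam_add, mulLam_add, par_add, par_ldir]
    rw [show mulLam (mulLam (ldir k)) = unitPath k 5 from rfl, h5]
    generalize cv _ = p
    generalize par x = q
    revert p q
    decide
  have hborder : ∀ f ∈ cells X, f.2.onBorder = true → ∀ y, ((y, Shape.vert) : Cell) ∈ f.subTwo →
      cv y = d f.1 + borderColour f y := by
    rintro ⟨x, _ | k | k | s⟩ hf hfb y hy
    · have hy' : y = mulLam (mulLam x) := by
        simpa [Cell.subTwo, Cell.sub, Shape.sub, shift] using hy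
      subst hy'
      show _ = cv (mulLam (mulLam x)) + par x + (par x + 0)
      generalize cv _ = p
      generalize par x = q
      revert p q
      decide
    · have hx : ((x, Shape.unit k) : Cell) = shift x (0, .unit k) := by simp [shift]
      have h1 := colouring_along_unit (hne _ hf rfl)
      rw [hx, subTwo_shift] at hy
      obtain ⟨⟨z, r⟩, hg, hgy⟩ := List.mem_map.1 hy
      simp only [shift, Prod.mk.injEq] at hgy
      obtain ⟨rfl, rfl⟩ := hgy
      have := unitPath_vert
      simp only [List.all_eq_true, List.any_eq_true, Bool.or_eq_true, Bool.and_eq_true,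
        beq_iff_eq, bne_iff_ne] at this
      obtain ⟨i, hi, rfl, hi'⟩ := (this k (mem_dirs k) _ hg).resolve_left (by simp)
      have hi5 : i ≤ 5 := by
        simp only [List.mem_cons, List.not_mem_nil, or_false] at hi
        omega
      rw [h1 i hi5, borderColour, add_sub_cancel_left, hi']
      show _ = cv (mulLam (mulLam x)) + par x + (par x + _)
      generalize cv _ = p
      generalize par x = q
      generalize Fin.ofNat 2 i = r
      revert p q r
      decide
    · simp [Shape.onBorder] at hfb
    · simp [Shape.onBorder] at hfb
  -- Unit sides connect all corners of a tile (for a triangle the two legs suffice), so the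
  -- discrepancy is constant on it.
  have hface : ∀ t ∈ X, ∀ f ∈ t.cell.faces, d f.1 = d t.1 := by
    intro t ht f hf
    have hedge : ∀ (z : Pt) k, ((z, Shape.unit k) : Cell) ∈ t.2.edges →
        d (t.1 + z + ldir k) = d (t.1 + z) := fun z k hz => by
      refine hunit _ _ ⟨t, ht, ?_⟩
      refine List.mem_map.2 ⟨(z, .unit k), List.mem_cons_of_mem _ (List.mem_append_right _ hz), rfl⟩
    have hv : ∀ v ∈ (Shape.tile t.2).verts, d (t.1 + v) = d t.1 := by
      have h5 : ∀ k : ZMod 8, ldir (k + 5) = -ldir (k + 1) := by decide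
      obtain ⟨x, k | ⟨h, e⟩⟩ := t
      · have h1 := hedge 0 k.val (by simp [TileShape.edges])
        have h2 := hedge 0 (k.val + 1) (by simp [TileShape.edges])
        have h3 := hedge (ldir k.val + ldir (k.val + 1)) (k.val + 5) (by simp [TileShape.edges])
        rw [h5, add_assoc, add_neg_cancel_right] at h3
        rw [add_zero] at h1 h2
        simp only [Shape.verts, List.mem_cons, List.not_mem_nil, or_false]
        rintro v (rfl | rfl | rfl | rfl)
        · rw [add_zero]
        · exact h1
        · exact h3.symm.trans h1
        · exact h2
      · have h1 := hedge 0 (h + 2 * sgn e) (by simp [TileShape.edges])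
        have h2 := hedge (ldir h) (h + 4) (by simp [TileShape.edges])
        rw [ldir_add_four, add_neg_cancel_right] at h2
        rw [add_zero] at h1
        simp only [Shape.verts, List.mem_cons, List.not_mem_nil, or_false]
        rintro v (rfl | rfl | rfl)
        · rw [add_zero]
        · exact h2.symm
        · exact h1
    obtain ⟨g, hg, rfl⟩ := List.mem_map.1 hf
    have := verts_faces_subset
    simp only [List.all_eq_true, List.contains_iff_mem] at this
    refine hv _ (this t.2 (mem_tileShapes _) g hg _ ?_)
    exact List.mem_map.2 ⟨0, zero_mem_verts _, add_zero _⟩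
  have hfaces : ∀ f ∈ cells X, ∀ f' ∈ f.faces, d f'.1 = d f.1 := by
    rintro f ⟨t, ht, hf⟩ f' hf'
    have : f' ∈ cells {t} := mem_cells_of_mem_faces ⟨t, rfl, hf⟩ hf'
    obtain ⟨_, rfl, hf'⟩ := this
    rw [hface _ ht f hf, hface _ ht f' hf']
  have hex : ∀ v : vertexSet (place O '' lsubst (lsubst X)), ∃ y, ∃ f ∈ cells X,
      ((y, Shape.vert) : Cell) ∈ f.subTwo ∧ O + emb y = v := by
    rintro ⟨v, hv⟩
    obtain ⟨y, hy, rfl⟩ := mem_vertexSet_place.1 hv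
    obtain ⟨f, hf, h⟩ := mem_cells_lsubst_lsubst.1 hy
    exact ⟨y, f, hf, h, rfl⟩
  choose y F hF hy hv using hex
  have key : ∀ v w : vertexSet (place O '' lsubst (lsubst X)),
      ∀ g ∈ cells (lsubst (lsubst X)), ∀ a b, g.Joins a b →
      (v : ℂ) = O + emb a → (w : ℂ) = O + emb b →
        flipColour (d (F v).1) (colour (F v) (y v)) ≠
          flipColour (d (F w).1) (colour (F w) (y w)) := by
    intro v w g hg a b hab hva hwb
    obtain ⟨f, hf, hg⟩ := mem_cells_lsubst_lsubst.1 hg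
    obtain ⟨f₁, hf₁, f₂, hf₂, ha, hb, hne⟩ := exists_colour_ne hg hab
    have ea : y v = a := emb_injective (add_left_cancel ((hv v).trans hva))
    have eb : y w = b := emb_injective (add_left_cancel ((hv w).trans hwb))
    have e1 : F v = f₁ := subTwo_vert_unique hX (hF v) (mem_cells_of_mem_faces hf hf₁) (hy v)
      (ea ▸ ha)
    have e2 : F w = f₂ := subTwo_vert_unique hX (hF w) (mem_cells_of_mem_faces hf hf₂) (hy w)
      (eb ▸ hb)
    -- Both ends of the edge lie over faces of one cell f, so the same exchange of colours is
    -- applied to both, and an exchange is injective.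
    rw [e1, e2, ea, eb, hfaces f hf f₁ hf₁, hfaces f hf f₂ hf₂]
    exact fun h => hne (flipColour_injective _ h)
  refine ⟨SimpleGraph.Coloring.mk (fun v => flipColour (d (F v).1) (colour (F v) (y v)))
    fun {v w} h => ?_, fun v => ?_⟩
  · obtain ⟨-, g, hg, a, b, hab, hs⟩ := graph_adj_place.1 h
    rcases Sym2.eq_iff.1 hs with ⟨h1, h2⟩ | ⟨h1, h2⟩
    · exact key v w g hg a b hab h1 h2
    · exact (key w v g hg a b hab h2 h1).symm
  · show flipColour (d (F v).1) (colour (F v) (y v)) = _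
    obtain ⟨f, hf, hfb, z, hz, hvz⟩ := (mem_borders hX hcov hO).1 v.2
    have ez : y v = z := emb_injective (add_left_cancel ((hv v).trans hvz))
    have e1 : F v = f := subTwo_vert_unique hX (hF v) hf (hy v) (ez ▸ hz)
    have hflip : ∀ a b : Fin 2, flipColour a b.castSucc = (a + b).castSucc := by decide
    rw [e1, ez, colour_of_onBorder hfb, hflip, ← hborder f hf hfb z hz, hcv v z hvz]

/-! ### The lower bound: hypotenuses are edges, so each triangle is a 3-cycle -/

theorem not_colorable_two {T : Set Tile} {a : ℂ} {h : ZMod 8} {e : Bool}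
    (ht : Tile.tri a h e ∈ T) : ¬ (graph T).Colorable 2 := by
  rintro ⟨C⟩
  have h0 : ∀ k, dir k ≠ 0 := fun k => Complex.exp_ne_zero _
  have h1 : dir h ≠ dir (h + 2 * sgn e) := by
    rw [← emb_ldir, ← emb_ldir]
    refine fun h' => ?_
    have : ∀ (h : ZMod 8) (e : Bool), ldir h ≠ ldir (h + 2 * sgn e) := by decide
    exact this h e (emb_injective h')
  let A : vertexSet T := ⟨a, _, ht, by simp [Tile.corners]⟩
  let B : vertexSet T := ⟨a + dir h, _, ht, by simp [Tile.corners]⟩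
  let D : vertexSet T := ⟨a + dir (h + 2 * sgn e), _, ht, by simp [Tile.corners]⟩
  have hAB : (graph T).Adj A B := by
    refine ⟨fun h' => h0 h ?_, _, ht, by simp [Tile.sides, A, B]⟩
    simpa [A, B] using congrArg Subtype.val h'
  have hBD : (graph T).Adj B D := by
    refine ⟨fun h' => h1 ?_, _, ht, by simp [Tile.sides, B, D]⟩
    simpa [B, D] using congrArg Subtype.val h'
  have hDA : (graph T).Adj D A := by
    refine ⟨fun h' => h0 _ (by simpa [D, A] using congrArg Subtype.val h'), _, ht,
      by simp [Tile.sides, D, A]⟩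
  have hfin : ∀ p q r : Fin 2, p ≠ q → q ≠ r → r ≠ p → False := by decide
  exact hfin _ _ _ (C.valid hAB) (C.valid hBD) (C.valid hDA)

theorem exists_tri_mem_children (t : Tile) : ∃ a h e, Tile.tri a h e ∈ t.children := by
  cases t
  · exact ⟨_, _, _, List.mem_cons_of_mem _ (List.mem_cons_of_mem _
      (List.mem_cons_of_mem _ List.mem_cons_self))⟩
  · exact ⟨_, _, _, by simp only [Tile.children]; exact List.mem_cons_self⟩

end AmmannBeenker

open AmmannBeenker in
/-- The chromatic number of an Ammann–Beenker tiling is 3, and a 3-colouring is induced by any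
2-colouring of the borders of the second-level supertiles. -/
theorem theorem4p1 (T : Set Tile) (hT : IsAmmannBeenker T) :
    (graph T).chromaticNumber = 3 ∧
    -- `T` is composed of second-level supertiles
    (∃ S : Set Tile, IsAmmannBeenker S ∧ subst (subst S) = T) ∧
    ∀ S : Set Tile, IsAmmannBeenker S → subst (subst S) = T →
      -- the borders of the rhombi are 20-cycles
      (∀ t ∈ S, t.IsRhomb → IsCycleOfLength (border T (supertile t.region)) 20) ∧
      -- the triangles come in pairs forming squares, whose borders are 20-cycles
      (∀ t ∈ S, t.IsTri → ∃! t' : Tile, t' ∈ S ∧ t.SharesHypotenuse t') ∧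
      (∀ t ∈ S, ∀ t' ∈ S, t.SharesHypotenuse t' →
        IsUnitSquare (t.region ∪ t'.region) ∧
        IsCycleOfLength (border T (supertile (t.region ∪ t'.region))) 20) ∧
      -- the union of all these borders can be 2-coloured, and every 2-colouring of it
      -- can be filled in, with a third colour in the interiors
      (borders T S).coe.Colorable 2 ∧
      ∀ c : (borders T S).coe.Coloring (Fin 2),
        ∃ C : (graph T).Coloring (Fin 3), ∀ v : (borders T S).verts, C v = (c v).castSucc := by
  have main : ∀ S : Set Tile, IsAmmannBeenker S → subst (subst S) = T →
      (∀ t ∈ S, t.IsRhomb → IsCycleOfLength (border T (supertile t.region)) 20) ∧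
      (∀ t ∈ S, t.IsTri → ∃! t' : Tile, t' ∈ S ∧ t.SharesHypotenuse t') ∧
      (∀ t ∈ S, ∀ t' ∈ S, t.SharesHypotenuse t' →
        IsUnitSquare (t.region ∪ t'.region) ∧
        IsCycleOfLength (border T (supertile (t.region ∪ t'.region))) 20) ∧
      (borders T S).coe.Colorable 2 ∧
      ∀ c : (borders T S).coe.Coloring (Fin 2),
        ∃ C : (graph T).Coloring (Fin 3), ∀ v : (borders T S).verts, C v = (c v).castSucc := by
    intro S hS hST
    obtain ⟨Q, X, rfl, hX⟩ := hS.exists_place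
    have hcov := hS.1.1
    rw [subst_image_place, subst_image_place] at hST
    subst hST
    refine ⟨?_, ?_, ?_, borders_colorable hX hcov rfl, exists_extension hX hcov rfl⟩
    · rintro _ ⟨t, ht, rfl⟩ hr
      have := isCycleOfLength_border hX (Q := Q) rfl (blockTiles_subset hX hcov ht)
      obtain ⟨x, k | ⟨h, e⟩⟩ := t
      · rwa [blockRegion_rhomb] at this
      · exact hr.elim
    · rintro _ ⟨t, ht, rfl⟩ hr
      obtain ⟨x, k | ⟨h, e⟩⟩ := t
      · exact hr.elim
      · have hp := partner_mem hX hcov ht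
        refine ⟨_, ⟨⟨_, hp, rfl⟩, (sharesHypotenuse_place hX ht hp).2 ⟨trivial, rfl⟩⟩, ?_⟩
        rintro _ ⟨⟨t', ht', rfl⟩, hs⟩
        rw [((sharesHypotenuse_place hX ht ht').1 hs).2]
    · rintro _ ⟨t, ht, rfl⟩ _ ⟨t', ht', rfl⟩ hs
      obtain ⟨htri, rfl⟩ := (sharesHypotenuse_place hX ht ht').1 hs
      have := isCycleOfLength_border hX (Q := Q) rfl (blockTiles_subset hX hcov ht)
      obtain ⟨x, k | ⟨h, e⟩⟩ := t
      · exact htri.elim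
      · rw [← blockRegion_tri]
        exact ⟨isUnitSquare_blockRegion Q x h e, this⟩
  have hex : ∃ S : Set Tile, IsAmmannBeenker S ∧ subst (subst S) = T := by
    obtain ⟨S₁, hS₁, h₁⟩ := hT.exists_subst_eq
    obtain ⟨S, hS, h⟩ := hS₁.exists_subst_eq
    exact ⟨S, hS, by rw [h, h₁]⟩
  refine ⟨?_, hex, main⟩
  obtain ⟨S, hS, hST⟩ := hex
  obtain ⟨-, -, -, ⟨c⟩, hext⟩ := main S hS hST
  obtain ⟨C, -⟩ := hext c
  have h3 : (graph T).Colorable (2 + 1) := ⟨C⟩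
  obtain ⟨t, ht⟩ := hS.1.nontrivial.nonempty
  -- Every dissected tile contains a triangle, so two levels below any tile of S there is a triangle
  -- of T.
  obtain ⟨a₁, h₁, e₁, hc₁⟩ := exists_tri_mem_children t
  obtain ⟨a₂, h₂, e₂, hc₂⟩ := exists_tri_mem_children (.tri a₁ h₁ e₁)
  have htri : Tile.tri a₂ h₂ e₂ ∈ T := hST ▸ ⟨_, ⟨t, ht, hc₁⟩, hc₂⟩
  exact (SimpleGraph.chromaticNumber_eq_iff_colorable_not_colorable (n := 2)).2
    ⟨h3, not_colorable_two htri⟩
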